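/- Let $n\ge 1$, let $\Omega\subset\mathbb{R}^n$ be a bounded domain with Lipschitz-continuous boundary, and let $\Gamma^D,\Gamma^N\subset\partial\Omega$ be boundary pieces, each covered by a fixed finite system of bi-Lipschitz local coordinates $\varphi_j:U_j\to\Gamma$ with bounded Lipschitz domains $U_j\subset\mathbb{R}^{n-1}$ and relatively open images in $\Gamma$. Put $\Omega_1=\Omega$, $\Omega_2=\Gamma^D$, $\Omega_3=\Gamma^N$, $n_1=n$, $n_2=n_3=n-1$, and, for a real number $m$, $(m_1,m_2,m_3)=(m,m+3/2,m+1/2)$. Let $T=T^1\times T^2\times T^3$ with $T^k=H^{m_k}(\Omega_k)$ and $\|f\|_T^2=\sum_k\|f_k\|_{T^k}^2$; here $H^r(U)=W^{r,2}(U)$ carries the Sobolev--Slobodeckij norm, and $H^r(\Gamma)$ consists of the functions $f$ with $f\circ\varphi_j\in H^r(U_j)$ for all $j$, with $\|f\|^2_{H^r(\Gamma)}=\sum_j\|f\circ\varphi_j\|^2_{H^r(U_j)}$. Let $\mu_1,\mu_2,\mu_3$ be nonnegative integers with $$m_k-\mu_k-n_k/2>0\qquad(k=1,2,3).$$ Let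 $c$ be a constant. For $s>0$ let $Y_s^k\subset\Omega_k$ be finite sets with fill distance $\sup_{x\in\Omega_k}\min_{y\in Y^k_s}|x-y|\le s$ and $\#Y_s^k\le c\,s^{-n_k}$. Let $T_s^k=\mathbb{R}^{\#\{\alpha:|\alpha|\le\mu_k\}\cdot\#Y_s^k}$ ($\alpha$ a multi-index in $n_k$ variables) with norm $s^{n_k/2}\|\cdot\|_2$, and $T_s=T_s^1\times T_s^2\times T_s^3$ with $\|v\|^2_{T_s}=\sum_k\|v_k\|^2_{T_s^k}$. Then the test discretization $\pi_s:T\to T_s$, $$\pi_s f=\Big(\big(\partial^\alpha f_k(y)\big)_{|\alpha|\le\mu_k,\;y\in Y_s^k}\Big)_{k=1,2,3},$$ is a well-defined bounded linear map: every $f_k\in T^k$ has exactly one representative on $\Omega_k$ that is $\mu_k$ times continuously differentiable, and $\partial^\alpha f_k(y)$ is its derivative at $y$ (for $k=2,3$ taken in any one of the local coordinate systems around $y$, chosen for each $y$). Moreover the operator norm satisfies $\|\pi_s\|_{T\to T_s}\le C$ with a constant $C$ that does not depend on $s$, on the sets $Y_s^k$ (subject to the bounds above), or on the choice of coordinates at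 the sample points. -/

import Mathlib

open MeasureTheory

open scoped ContDiff

noncomputable section

/-- `∂ g / ∂ x i`. -/
def partialDeriv {N : ℕ} (i : Fin N) (g : EuclideanSpace ℝ (Fin N) → ℝ) :
    EuclideanSpace ℝ (Fin N) → ℝ :=
  fun x => fderiv ℝ g x (EuclideanSpace.single i (1 : ℝ))

/-- The iterated classical partial derivative `∂^α g` for a multi-index `α`. -/
def multiDeriv {N : ℕ} (α : Fin N → ℕ) (g : EuclideanSpace ℝ (Fin N) → ℝ) :
    EuclideanSpace ℝ (Fin N) → ℝ :=
  (List.finRange N).foldr (fun i h => (partialDeriv i)^[α i] h) g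

/-- Multi-indices `α` in `N` variables with `|α| ≤ k`. -/
def MultiIndex (N k : ℕ) : Type := {α : Fin N → ℕ // ∑ i, α i ≤ k}

instance (N k : ℕ) : Fintype (MultiIndex N k) :=
  Fintype.ofInjective
    (fun (α : MultiIndex N k) (i : Fin N) =>
      (⟨α.1 i, Nat.lt_succ_of_le
        ((Finset.single_le_sum (f := α.1) (fun _ _ => Nat.zero_le _) (Finset.mem_univ i)).trans
          α.2)⟩ : Fin (k + 1)))
    (fun _ _ h => Subtype.ext (funext fun i => congrArg Fin.val (congrFun h i)))

/-- The zero multi-index. -/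
def MultiIndex.zero (N k : ℕ) : MultiIndex N k := ⟨0, by simp⟩

/-- Multi-indices `α` in `N` variables with `|α| = k`. -/
abbrev TopMultiIndex (N k : ℕ) : Type := {α : MultiIndex N k // ∑ i, α.1 i = k}

/-- A bounded domain (nonempty, open, connected) with Lipschitz-continuous boundary: near each
boundary point, in suitable Cartesian coordinates with last axis `e`, the set is the open
epigraph of a Lipschitz function of the remaining coordinates. -/
structure IsLipschitzDomain {N : ℕ} (Ω : Set (EuclideanSpace ℝ (Fin N))) : Prop where
  isOpen : IsOpen Ω
  isConnected : IsConnected Ω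
  isBounded : Bornology.IsBounded Ω
  lipschitz_boundary : ∀ x ∈ frontier Ω, ∃ e : EuclideanSpace ℝ (Fin N), ‖e‖ = 1 ∧
    ∃ (K : NNReal) (γ : (Submodule.span ℝ {e})ᗮ → ℝ), LipschitzWith K γ ∧
      ∃ V ∈ nhds x, ∀ y ∈ V,
        (y ∈ Ω ↔ γ ((Submodule.span ℝ {e})ᗮ.orthogonalProjectionOnto y) < inner ℝ e y)

/-- `h` is the weak derivative `∂^α f` on `Ω`. -/
def HasWeakDeriv {N : ℕ} (Ω : Set (EuclideanSpace ℝ (Fin N))) (α : Fin N → ℕ)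
    (f h : EuclideanSpace ℝ (Fin N) → ℝ) : Prop :=
  ∀ φ : EuclideanSpace ℝ (Fin N) → ℝ, ContDiff ℝ ∞ φ → HasCompactSupport φ → tsupport φ ⊆ Ω →
    ∫ x in Ω, f x * multiDeriv α φ x = (-1 : ℝ) ^ (∑ i, α i) * ∫ x in Ω, h x * φ x

theorem partialDeriv_smooth {N : ℕ} (i : Fin N) {φ : EuclideanSpace ℝ (Fin N) → ℝ}
    (h : ContDiff ℝ ∞ φ ∧ HasCompactSupport φ) :
    ContDiff ℝ ∞ (partialDeriv i φ) ∧ HasCompactSupport (partialDeriv i φ) :=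
  ⟨(h.1.fderiv_right (m := ∞) (by simp)).clm_apply contDiff_const, h.2.fderiv_apply ℝ _⟩

theorem multiDeriv_smooth {N : ℕ} (α : Fin N → ℕ) {φ : EuclideanSpace ℝ (Fin N) → ℝ}
    (h : ContDiff ℝ ∞ φ ∧ HasCompactSupport φ) :
    ContDiff ℝ ∞ (multiDeriv α φ) ∧ HasCompactSupport (multiDeriv α φ) := by
  unfold multiDeriv
  induction List.finRange N with
  | nil => exact h
  | cons i l ih =>
    rw [List.foldr_cons]
    induction α i with
    | zero => exact ih
    | succ n ihn =>
      rw [Function.iterate_succ_apply']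
      exact partialDeriv_smooth i ihn

theorem integrable_mul_test {N : ℕ} {Ω : Set (EuclideanSpace ℝ (Fin N))}
    (f : Lp ℝ 2 (volume.restrict Ω)) {φ : EuclideanSpace ℝ (Fin N) → ℝ}
    (h : ContDiff ℝ ∞ φ ∧ HasCompactSupport φ) :
    Integrable (fun x => f x * φ x) (volume.restrict Ω) :=
  (Lp.memLp f).integrable_mul
    ((h.1.continuous.memLp_of_hasCompactSupport (p := 2) h.2))

theorem HasWeakDeriv.add {N : ℕ} {Ω : Set (EuclideanSpace ℝ (Fin N))} {α : Fin N → ℕ}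
    {f h f' h' : Lp ℝ 2 (volume.restrict Ω)} (H : HasWeakDeriv Ω α f h)
    (H' : HasWeakDeriv Ω α f' h') : HasWeakDeriv Ω α (f + f' : Lp ℝ 2 _) (h + h' : Lp ℝ 2 _) := by
  intro φ h1 h2 h3
  have key : ∀ (a b : Lp ℝ 2 (volume.restrict Ω)) (ψ : EuclideanSpace ℝ (Fin N) → ℝ),
      ContDiff ℝ ∞ ψ ∧ HasCompactSupport ψ →
      ∫ x in Ω, (a + b : Lp ℝ 2 _) x * ψ x = (∫ x in Ω, a x * ψ x) + ∫ x in Ω, b x * ψ x := by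
    intro a b ψ hψ
    rw [← integral_add (integrable_mul_test a hψ) (integrable_mul_test b hψ)]
    refine integral_congr_ae ?_
    filter_upwards [Lp.coeFn_add a b] with x hx
    rw [hx, Pi.add_apply, add_mul]
  rw [key _ _ _ (multiDeriv_smooth α ⟨h1, h2⟩), key _ _ _ ⟨h1, h2⟩, H φ h1 h2 h3, H' φ h1 h2 h3,
    mul_add]

theorem HasWeakDeriv.smul {N : ℕ} {Ω : Set (EuclideanSpace ℝ (Fin N))} {α : Fin N → ℕ}
    {f h : Lp ℝ 2 (volume.restrict Ω)} (c : ℝ) (H : HasWeakDeriv Ω α f h) :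
    HasWeakDeriv Ω α (c • f : Lp ℝ 2 _) (c • h : Lp ℝ 2 _) := by
  intro φ h1 h2 h3
  have key : ∀ (a : Lp ℝ 2 (volume.restrict Ω)) (ψ : EuclideanSpace ℝ (Fin N) → ℝ),
      ∫ x in Ω, (c • a : Lp ℝ 2 _) x * ψ x = c * ∫ x in Ω, a x * ψ x := by
    intro a ψ
    rw [← integral_const_mul]
    refine integral_congr_ae ?_
    filter_upwards [Lp.coeFn_smul c a] with x hx
    rw [hx, Pi.smul_apply, smul_eq_mul, mul_assoc]
  rw [key, key, H φ h1 h2 h3]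
  ring

/-- The Hilbert space in which the Sobolev space of order `r` over `Ω` sits via
`f ↦ ((∂^α f)_{|α| ≤ ⌊r⌋}, (difference quotients of ∂^α f)_{|α| = ⌊r⌋})`; all sums of norms
are `ℓ²`-sums. -/
abbrev SobolevAmbient {N : ℕ} (r : ℝ) (Ω : Set (EuclideanSpace ℝ (Fin N))) : Type :=
  WithLp 2
    (PiLp 2 (fun _ : MultiIndex N ⌊r⌋₊ => Lp ℝ 2 (volume.restrict Ω)) ×
     PiLp 2 (fun _ : TopMultiIndex N ⌊r⌋₊ =>
      Lp ℝ 2 ((volume.restrict Ω).prod (volume.restrict Ω))))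

/-- `G` is the Slobodeckij difference quotient of `f`,
`G (x, y) = (f x - f y) / |x - y| ^ (N / 2 + σ)`, where `σ ∈ (0, 1)`; for `σ = 0` there is no
such term. The square of its `L²` norm is
`∫∫ |f x - f y| ^ 2 / |x - y| ^ (N + 2 σ) dx dy`. -/
def IsDifferenceQuotient {N : ℕ} {Ω : Set (EuclideanSpace ℝ (Fin N))} (σ : ℝ)
    (f : Lp ℝ 2 (volume.restrict Ω))
    (G : Lp ℝ 2 ((volume.restrict Ω).prod (volume.restrict Ω))) : Prop :=
  (σ = 0 → G = 0) ∧
  (σ ≠ 0 → ∀ᵐ p ∂((volume.restrict Ω).prod (volume.restrict Ω)),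
    G p = (f p.1 - f p.2) / ‖p.1 - p.2‖ ^ ((N : ℝ) / 2 + σ))

theorem IsDifferenceQuotient.add {N : ℕ} {Ω : Set (EuclideanSpace ℝ (Fin N))} {σ : ℝ}
    {f f' : Lp ℝ 2 (volume.restrict Ω)}
    {G G' : Lp ℝ 2 ((volume.restrict Ω).prod (volume.restrict Ω))}
    (H : IsDifferenceQuotient σ f G) (H' : IsDifferenceQuotient σ f' G') :
    IsDifferenceQuotient σ (f + f') (G + G') := by
  refine ⟨fun h => by rw [H.1 h, H'.1 h, add_zero], fun h => ?_⟩
  filter_upwards [H.2 h, H'.2 h, Lp.coeFn_add G G',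
    Measure.quasiMeasurePreserving_fst.ae (Lp.coeFn_add f f'),
    Measure.quasiMeasurePreserving_snd.ae (Lp.coeFn_add f f')] with p h1 h2 h3 h4 h5
  rw [h3, Pi.add_apply, h1, h2, h4, h5, Pi.add_apply, Pi.add_apply]
  ring

theorem IsDifferenceQuotient.smul {N : ℕ} {Ω : Set (EuclideanSpace ℝ (Fin N))} {σ : ℝ}
    {f : Lp ℝ 2 (volume.restrict Ω)}
    {G : Lp ℝ 2 ((volume.restrict Ω).prod (volume.restrict Ω))}
    (c : ℝ) (H : IsDifferenceQuotient σ f G) : IsDifferenceQuotient σ (c • f) (c • G) := by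
  refine ⟨fun h => by rw [H.1 h, smul_zero], fun h => ?_⟩
  filter_upwards [H.2 h, Lp.coeFn_smul c G,
    Measure.quasiMeasurePreserving_fst.ae (Lp.coeFn_smul c f),
    Measure.quasiMeasurePreserving_snd.ae (Lp.coeFn_smul c f)] with p h1 h3 h4 h5
  rw [h3, Pi.smul_apply, h1, h4, h5, Pi.smul_apply, Pi.smul_apply]
  simp only [smul_eq_mul]
  ring

/-- The Sobolev space `H^r(Ω) = W^{r,2}(Ω)`, `r ≥ 0` real, with the norm
`‖f‖² = ∑_{|α| ≤ ⌊r⌋} ‖∂^α f‖²_{L²(Ω)}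
  + ∑_{|α| = ⌊r⌋} ∫∫ |∂^α f x - ∂^α f y|² / |x - y|^(N + 2 (r - ⌊r⌋)) dx dy`
(second sum only for `r` not an integer). An element is recorded together with its weak
derivatives and difference quotients, which it determines, so that the norm is the inherited
Hilbert norm. -/
def sobolevSubmodule {N : ℕ} (r : ℝ) (Ω : Set (EuclideanSpace ℝ (Fin N))) :
    Submodule ℝ (SobolevAmbient r Ω) where
  carrier := {F |
    (∀ α : MultiIndex N ⌊r⌋₊, HasWeakDeriv Ω α.1 (F.fst (MultiIndex.zero N _)) (F.fst α)) ∧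
    ∀ α : TopMultiIndex N ⌊r⌋₊, IsDifferenceQuotient (r - ⌊r⌋₊) (F.fst α.1) (F.snd α)}
  add_mem' := fun {_ _} hF hG =>
    ⟨fun α => (hF.1 α).add (hG.1 α), fun α => (hF.2 α).add (hG.2 α)⟩
  zero_mem' := by
    have h0 : ∀ α, HasWeakDeriv Ω α (0 : Lp ℝ 2 (volume.restrict Ω))
        (0 : Lp ℝ 2 (volume.restrict Ω)) := fun α φ _ _ _ => by
      have : ∀ ψ : EuclideanSpace ℝ (Fin N) → ℝ,
          ∫ x in Ω, (0 : Lp ℝ 2 (volume.restrict Ω)) x * ψ x = 0 := by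
        intro ψ
        rw [← integral_zero (EuclideanSpace ℝ (Fin N)) ℝ (μ := volume.restrict Ω)]
        refine integral_congr_ae ?_
        filter_upwards [Lp.coeFn_zero ℝ 2 (volume.restrict Ω)] with x hx
        rw [hx, Pi.zero_apply, zero_mul]
      rw [this, this, mul_zero]
    have h1 : ∀ σ, IsDifferenceQuotient σ (0 : Lp ℝ 2 (volume.restrict Ω)) 0 := fun σ =>
      ⟨fun _ => rfl, fun _ => by
        filter_upwards [Lp.coeFn_zero ℝ 2 ((volume.restrict Ω).prod (volume.restrict Ω)),
          Measure.quasiMeasurePreserving_fst.ae (Lp.coeFn_zero ℝ 2 (volume.restrict Ω)),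
          Measure.quasiMeasurePreserving_snd.ae (Lp.coeFn_zero ℝ 2 (volume.restrict Ω))]
          with p h1 h2 h3
        rw [h1, h2, h3]
        simp⟩
    exact ⟨fun α => h0 _, fun α => h1 _⟩
  smul_mem' := fun c _ hF => ⟨fun α => (hF.1 α).smul c, fun α => (hF.2 α).smul c⟩

/-- The Sobolev space `H^r(Ω)` as a normed space. -/
def SobolevSpace {N : ℕ} (r : ℝ) (Ω : Set (EuclideanSpace ℝ (Fin N))) : Type :=
  sobolevSubmodule r Ω

instance {N : ℕ} (r : ℝ) (Ω : Set (EuclideanSpace ℝ (Fin N))) :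
    NormedAddCommGroup (SobolevSpace r Ω) :=
  inferInstanceAs (NormedAddCommGroup (sobolevSubmodule r Ω))

instance {N : ℕ} (r : ℝ) (Ω : Set (EuclideanSpace ℝ (Fin N))) :
    NormedSpace ℝ (SobolevSpace r Ω) :=
  inferInstanceAs (NormedSpace ℝ (sobolevSubmodule r Ω))

/-- The function (class modulo null sets) underlying an element of `H^r(Ω)`. -/
def SobolevSpace.toLp {N : ℕ} {r : ℝ} {Ω : Set (EuclideanSpace ℝ (Fin N))}
    (F : SobolevSpace r Ω) : Lp ℝ 2 (volume.restrict Ω) :=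
  F.1.fst (MultiIndex.zero N _)

/-- A finite system of bi-Lipschitz local coordinates, with bounded Lipschitz domains of `ℝ^d`
as parameter domains, on a `d`-dimensional hypersurface piece `Γ` of `ℝ^(d+1)`. -/
structure LipschitzAtlas {d : ℕ} (Γ : Set (EuclideanSpace ℝ (Fin (d + 1)))) where
  numCharts : ℕ
  dom : Fin numCharts → Set (EuclideanSpace ℝ (Fin d))
  chart : Fin numCharts → EuclideanSpace ℝ (Fin d) → EuclideanSpace ℝ (Fin (d + 1))
  dom_lipschitz : ∀ j, IsLipschitzDomain (dom j)
  chart_lipschitz : ∀ j, ∃ K : NNReal, LipschitzOnWith K (chart j) (dom j)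
  chart_antilipschitz : ∀ j, ∃ K : ℝ, ∀ x ∈ dom j, ∀ y ∈ dom j,
    dist x y ≤ K * dist (chart j x) (chart j y)
  isOpen_image : ∀ j, ∃ V : Set (EuclideanSpace ℝ (Fin (d + 1))),
    IsOpen V ∧ chart j '' dom j = V ∩ Γ
  cover : ⋃ j, chart j '' dom j = Γ

/-- The Sobolev space `H^r(Γ)` on a hypersurface piece with local coordinates `φ_j : U_j → Γ`:
the (classes of) functions `f` on `Γ` such that `f ∘ φ_j ∈ H^r(U_j)` for all `j`, with
`‖f‖² = ∑ j, ‖f ∘ φ_j‖²_{H^r(U_j)}`. -/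
def boundarySobolevSubmodule {d : ℕ} (r : ℝ) {Γ : Set (EuclideanSpace ℝ (Fin (d + 1)))}
    (A : LipschitzAtlas Γ) : Submodule ℝ (PiLp 2 (fun j => SobolevSpace r (A.dom j))) where
  carrier := {F | ∃ f : EuclideanSpace ℝ (Fin (d + 1)) → ℝ, ∀ j,
    f ∘ A.chart j =ᵐ[volume.restrict (A.dom j)] (F j).toLp}
  add_mem' := by
    rintro F G ⟨f, hf⟩ ⟨g, hg⟩
    refine ⟨f + g, fun j => ?_⟩
    filter_upwards [hf j, hg j, Lp.coeFn_add (F j).toLp (G j).toLp] with x h1 h2 h3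
    exact (congrArg₂ (· + ·) h1 h2).trans h3.symm
  zero_mem' := ⟨0, fun j => (Lp.coeFn_zero ℝ 2 (volume.restrict (A.dom j))).symm⟩
  smul_mem' := by
    rintro c F ⟨f, hf⟩
    refine ⟨c • f, fun j => ?_⟩
    filter_upwards [hf j, Lp.coeFn_smul c (F j).toLp] with x h1 h3
    exact (congrArg (c • ·) h1).trans h3.symm

/-- The Sobolev space `H^r(Γ)` as a normed space. -/
def BoundarySobolevSpace {d : ℕ} (r : ℝ) {Γ : Set (EuclideanSpace ℝ (Fin (d + 1)))}
    (A : LipschitzAtlas Γ) : Type :=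
  boundarySobolevSubmodule r A

instance {d : ℕ} (r : ℝ) {Γ : Set (EuclideanSpace ℝ (Fin (d + 1)))} (A : LipschitzAtlas Γ) :
    NormedAddCommGroup (BoundarySobolevSpace r A) :=
  inferInstanceAs (NormedAddCommGroup (boundarySobolevSubmodule r A))

instance {d : ℕ} (r : ℝ) {Γ : Set (EuclideanSpace ℝ (Fin (d + 1)))} (A : LipschitzAtlas Γ) :
    NormedSpace ℝ (BoundarySobolevSpace r A) :=
  inferInstanceAs (NormedSpace ℝ (boundarySobolevSubmodule r A))

/-- The test space `T = H^m(Ω) × H^(m+3/2)(Γ^D) × H^(m+1/2)(Γ^N)` with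
`‖f‖² = ‖f₁‖² + ‖f₂‖² + ‖f₃‖²`. -/
abbrev TestSpace {d : ℕ} (m : ℝ) (Ω : Set (EuclideanSpace ℝ (Fin (d + 1))))
    {ΓD ΓN : Set (EuclideanSpace ℝ (Fin (d + 1)))} (AD : LipschitzAtlas ΓD)
    (AN : LipschitzAtlas ΓN) : Type :=
  WithLp 2 (SobolevSpace m Ω ×
    WithLp 2 (BoundarySobolevSpace (m + 3 / 2) AD × BoundarySobolevSpace (m + 1 / 2) AN))

/-- `g` is a `C^μ` representative of `f ∈ H^r(Ω)`. -/
def IsSmoothRep {N : ℕ} {r : ℝ} {Ω : Set (EuclideanSpace ℝ (Fin N))} (μ : ℕ)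
    (f : SobolevSpace r Ω) (g : EuclideanSpace ℝ (Fin N) → ℝ) : Prop :=
  ContDiffOn ℝ μ g Ω ∧ g =ᵐ[volume.restrict Ω] f.toLp

/-- `g` is a `C^μ` representative (in the local coordinates) of `f ∈ H^r(Γ)`. -/
def IsBoundarySmoothRep {d : ℕ} {r : ℝ} {Γ : Set (EuclideanSpace ℝ (Fin (d + 1)))}
    {A : LipschitzAtlas Γ} (μ : ℕ) (f : BoundarySobolevSpace r A)
    (g : EuclideanSpace ℝ (Fin (d + 1)) → ℝ) : Prop :=
  ∀ j, IsSmoothRep μ (f.1 j) (g ∘ A.chart j)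

/-- The discrete space `ℝ^κ` with the norm `s^(n/2) ‖·‖₂`. -/
def DiscreteTestSpace (_s : Set.Ioi (0 : ℝ)) (_n : ℕ) (κ : Type) : Type := EuclideanSpace ℝ κ

namespace DiscreteTestSpace

variable (s : Set.Ioi (0 : ℝ)) (n : ℕ) (κ : Type)

instance : AddCommGroup (DiscreteTestSpace s n κ) :=
  inferInstanceAs (AddCommGroup (EuclideanSpace ℝ κ))

instance : Module ℝ (DiscreteTestSpace s n κ) :=
  inferInstanceAs (Module ℝ (EuclideanSpace ℝ κ))

/-- The vector of `ℝ^κ` underlying an element. -/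
def toEuclidean : DiscreteTestSpace s n κ →ₗ[ℝ] EuclideanSpace ℝ κ := LinearMap.id

/-- Multiplication by `s^(n/2)`. -/
def scale : DiscreteTestSpace s n κ →ₗ[ℝ] EuclideanSpace ℝ κ :=
  ((s : ℝ) ^ ((n : ℝ) / 2)) • toEuclidean s n κ

theorem scale_injective : Function.Injective (scale s n κ) :=
  smul_right_injective (EuclideanSpace ℝ κ) (Real.rpow_pos_of_pos s.2 _).ne'

variable [Fintype κ]

instance : NormedAddCommGroup (DiscreteTestSpace s n κ) :=
  NormedAddCommGroup.induced _ _ (scale s n κ) (scale_injective s n κ)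

instance : NormedSpace ℝ (DiscreteTestSpace s n κ) :=
  NormedSpace.induced ℝ _ _ (scale s n κ)

theorem norm_eq (v : DiscreteTestSpace s n κ) :
    ‖v‖ = (s : ℝ) ^ ((n : ℝ) / 2) * ‖toEuclidean s n κ v‖ := by
  change ‖((s : ℝ) ^ ((n : ℝ) / 2)) • toEuclidean s n κ v‖ = _
  rw [norm_smul, Real.norm_of_nonneg (Real.rpow_pos_of_pos s.2 _).le]

/-- The element with given components. -/
def mk {κ : Type} (v : κ → ℝ) : DiscreteTestSpace s n κ := WithLp.toLp 2 v

end DiscreteTestSpace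

/-- `δ(Y, Γ) = sup_{x ∈ Γ} min_{y ∈ Y} |x - y|` (infinite if `Y` is empty and `Γ` is not). -/
def fillDistance {N : ℕ} (Y Γ : Set (EuclideanSpace ℝ (Fin N))) : ENNReal :=
  ⨆ x ∈ Γ, Metric.infEDist x Y

/-- Finite sets of sample points of `Ω` with fill distance at most `s` and cardinality at most
`c s^(-N)`. -/
structure DomainSample {N : ℕ} (Ω : Set (EuclideanSpace ℝ (Fin N))) (c : ℝ)
    (s : Set.Ioi (0 : ℝ)) where
  pts : Finset (EuclideanSpace ℝ (Fin N))
  pts_subset : (pts : Set (EuclideanSpace ℝ (Fin N))) ⊆ Ω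
  fill : fillDistance (pts : Set (EuclideanSpace ℝ (Fin N))) Ω ≤ ENNReal.ofReal s
  card_le : (pts.card : ℝ) ≤ c * ((s : ℝ) ^ N)⁻¹

/-- Finite sets of sample points of a `d`-dimensional hypersurface piece `Γ` with fill distance at
most `s` and cardinality at most `c s^(-d)`; for each sample point one of the local coordinate
systems around it is selected, in which derivatives at that point are taken. -/
structure BoundarySample {d : ℕ} {Γ : Set (EuclideanSpace ℝ (Fin (d + 1)))}
    (A : LipschitzAtlas Γ) (c : ℝ) (s : Set.Ioi (0 : ℝ)) where
  pts : Finset (EuclideanSpace ℝ (Fin (d + 1)))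
  pts_subset : (pts : Set (EuclideanSpace ℝ (Fin (d + 1)))) ⊆ Γ
  fill : fillDistance (pts : Set (EuclideanSpace ℝ (Fin (d + 1)))) Γ ≤ ENNReal.ofReal s
  card_le : (pts.card : ℝ) ≤ c * ((s : ℝ) ^ d)⁻¹
  idx : pts → Fin A.numCharts
  coord : pts → EuclideanSpace ℝ (Fin d)
  coord_mem : ∀ y, coord y ∈ A.dom (idx y)
  chart_coord : ∀ y, A.chart (idx y) (coord y) = y

/-- The samples `(∂^α g (y))`, `|α| ≤ μ`, `y ∈ Y`. -/
def domainSamples {N : ℕ} {Ω : Set (EuclideanSpace ℝ (Fin N))} {c : ℝ} {s : Set.Ioi (0 : ℝ)}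
    (Y : DomainSample Ω c s) (μ : ℕ) (g : EuclideanSpace ℝ (Fin N) → ℝ) :
    DiscreteTestSpace s N (MultiIndex N μ × Y.pts) :=
  DiscreteTestSpace.mk s N fun p => multiDeriv p.1.1 g p.2.1

/-- The samples `(∂^α g (y))`, `|α| ≤ μ`, `y ∈ Y`, with derivatives in the local coordinates
selected at `y`. -/
def boundarySamples {d : ℕ} {Γ : Set (EuclideanSpace ℝ (Fin (d + 1)))} {A : LipschitzAtlas Γ}
    {c : ℝ} {s : Set.Ioi (0 : ℝ)} (Y : BoundarySample A c s) (μ : ℕ)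
    (g : EuclideanSpace ℝ (Fin (d + 1)) → ℝ) :
    DiscreteTestSpace s d (MultiIndex d μ × Y.pts) :=
  DiscreteTestSpace.mk s d fun p => multiDeriv p.1.1 (g ∘ A.chart (Y.idx p.2)) (Y.coord p.2)

/-- The discrete test space `T_s = T_s^1 × T_s^2 × T_s^3` with
`‖v‖² = ‖v₁‖² + ‖v₂‖² + ‖v₃‖²`. -/
abbrev ProductDiscreteTestSpace {d : ℕ} {Ω ΓD ΓN : Set (EuclideanSpace ℝ (Fin (d + 1)))}
    {AD : LipschitzAtlas ΓD} {AN : LipschitzAtlas ΓN} {c : ℝ} {s : Set.Ioi (0 : ℝ)}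
    (μ₁ μ₂ μ₃ : ℕ) (Y₁ : DomainSample Ω c s) (Y₂ : BoundarySample AD c s)
    (Y₃ : BoundarySample AN c s) : Type :=
  WithLp 2 (DiscreteTestSpace s (d + 1) (MultiIndex (d + 1) μ₁ × Y₁.pts) ×
    WithLp 2 (DiscreteTestSpace s d (MultiIndex d μ₂ × Y₂.pts) ×
      DiscreteTestSpace s d (MultiIndex d μ₃ × Y₃.pts)))

/-- `π` is the test discretization `π_s f = ((∂^α f_k) restricted to Y_k)_{k, |α| ≤ μ_k}`: on each
`f` it returns the samples of the `C^(μ_k)` representatives of the components `f_k`. -/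
def IsTestDiscretization {d : ℕ} {m : ℝ} {Ω ΓD ΓN : Set (EuclideanSpace ℝ (Fin (d + 1)))}
    {AD : LipschitzAtlas ΓD} {AN : LipschitzAtlas ΓN} {c : ℝ} {s : Set.Ioi (0 : ℝ)}
    (μ₁ μ₂ μ₃ : ℕ) (Y₁ : DomainSample Ω c s) (Y₂ : BoundarySample AD c s)
    (Y₃ : BoundarySample AN c s)
    (π : TestSpace m Ω AD AN → ProductDiscreteTestSpace μ₁ μ₂ μ₃ Y₁ Y₂ Y₃) : Prop :=
  ∀ (f : TestSpace m Ω AD AN) (g₁ g₂ g₃ : EuclideanSpace ℝ (Fin (d + 1)) → ℝ),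
    IsSmoothRep μ₁ f.fst g₁ → IsBoundarySmoothRep μ₂ f.snd.fst g₂ →
    IsBoundarySmoothRep μ₃ f.snd.snd g₃ →
    π f = WithLp.toLp 2 (domainSamples Y₁ μ₁ g₁,
      WithLp.toLp 2 (boundarySamples Y₂ μ₂ g₂, boundarySamples Y₃ μ₃ g₃))

end

/-!
The core is the Sobolev embedding `H^r(Ω) ⊂ C^μ_b(Ω)`, `r > μ + N / 2`, for a bounded Lipschitz
domain `Ω` and real `r`. It bounds every sample `∂^α f(y)` by `C ‖f‖`; at most `c s^(-N)` sample
points, weighted with `s^N` in the squared norm of the discrete space, then give a bound that does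
not depend on `s`.

The embedding is proved by weighted means. By compactness `Ω` is covered by finitely many open sets
`W` whose points in `Ω` are vertices of congruent parallel cones inside `Ω`
(`IsLipschitzDomain.exists_interiorCones`). On `W`, consider the means
`A_t f(x) = ∫ f(x + t w) K(w) dw`, where `K` is a test function in the base ball of the cone with
`∫ K = 1` and vanishing moments of orders `1, …, k`, `k = ⌊r⌋`. Instead of moments, what is used is
that `div (w K)` is a `(k + 1)`-fold divergence of test functions. For `E φ = div (w φ)` one has
`[E, ∂_i] = -∂_i`, so that `E + j` raises the order of a `j`-fold divergence by one, and
`K = ∏_{j ≤ k} (1 + E / j) η` has the property for every bump `η` (`exists_kernel`). Since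
`d/dt A_t f(x) = -t⁻¹ ∫ f(x + t w) (E K)(w) dw`, moving `k` derivatives to `f` gains `t^k`, and the
last divergence makes the test function mean-free, so that the Slobodeckij seminorm of order
`σ = r - k` gains `t^σ` (`SobolevBound.exists_pairing_bound`). Thus
`|d/dt A_t f(x)| ≤ C ‖f‖ t^(r - N / 2 - 1)`, which is integrable at `0`, and `A_t f` converges
uniformly as `t → 0`. The limit is continuous, bounded by `C ‖f‖`, and equal to `f` almost
everywhere by Lebesgue's differentiation theorem (`SobolevBound.exists_continuous_limit`).

The same applies to all weak derivatives of order at most `μ`. As `∂_i A_t f = A_t (∂_i f)`, their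
limits are classical derivatives of one another
(`hasFDerivAt_of_tendstoUniformlyOn_kernelAverage`), which gives a `C^μ` representative.

On a boundary piece the representatives in the charts must fit together. Transition maps are
bi-Lipschitz and hence preserve null sets, so two representatives agree almost everywhere, and by
continuity everywhere, on overlaps (`LipschitzAtlas.eq_of_chart_eq`).
-/

open MeasureTheory Filter Topology
open scoped ContDiff

noncomputable section

/-! ### Algebra of iterated partial derivatives -/

theorem ContDiff.partialDeriv {N : ℕ} (i : Fin N) {φ : EuclideanSpace ℝ (Fin N) → ℝ}
    (h : ContDiff ℝ ∞ φ) : ContDiff ℝ ∞ (partialDeriv i φ) :=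
  (h.fderiv_right (m := ∞) (by simp)).clm_apply contDiff_const

theorem ContDiff.partialDeriv_iterate {N : ℕ} (i : Fin N) (n : ℕ)
    {φ : EuclideanSpace ℝ (Fin N) → ℝ} (h : ContDiff ℝ ∞ φ) :
    ContDiff ℝ ∞ ((_root_.partialDeriv i)^[n] φ) := by
  induction n with
  | zero => exact h
  | succ n ih => rw [Function.iterate_succ_apply']; exact ih.partialDeriv i

theorem fderiv_partialDeriv_apply {N : ℕ} (i : Fin N) {φ : EuclideanSpace ℝ (Fin N) → ℝ}
    (h : ContDiff ℝ ∞ φ) (x v : EuclideanSpace ℝ (Fin N)) :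
    fderiv ℝ (partialDeriv i φ) x v
      = fderiv ℝ (fderiv ℝ φ) x v (EuclideanSpace.single i (1 : ℝ)) := by
  have hd : DifferentiableAt ℝ (fderiv ℝ φ) x :=
    ((h.fderiv_right (m := ∞) (by simp)).differentiable (by simp)).differentiableAt
  have := hd.hasFDerivAt.clm_apply
    (hasFDerivAt_const (EuclideanSpace.single i (1 : ℝ)) x)
  have h2 := this.fderiv
  change fderiv ℝ (fun y => fderiv ℝ φ y (EuclideanSpace.single i (1 : ℝ))) x v = _
  rw [h2]
  simp

theorem fderiv_fderiv_symm {N : ℕ} {φ : EuclideanSpace ℝ (Fin N) → ℝ}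
    (h : ContDiff ℝ ∞ φ) (x v w : EuclideanSpace ℝ (Fin N)) :
    fderiv ℝ (fderiv ℝ φ) x v w = fderiv ℝ (fderiv ℝ φ) x w v :=
  (h.contDiffAt (x := x)).isSymmSndFDerivAt
    (by simpa using WithTop.coe_le_coe.2 (le_top : (2 : ℕ∞) ≤ ⊤)) v w

theorem partialDeriv_comm {N : ℕ} (i j : Fin N) {φ : EuclideanSpace ℝ (Fin N) → ℝ}
    (h : ContDiff ℝ ∞ φ) :
    partialDeriv i (partialDeriv j φ) = partialDeriv j (partialDeriv i φ) := by
  funext x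
  change fderiv ℝ (partialDeriv j φ) x _ = fderiv ℝ (partialDeriv i φ) x _
  rw [fderiv_partialDeriv_apply j h, fderiv_partialDeriv_apply i h, fderiv_fderiv_symm h]

theorem partialDeriv_iterate_comm {N : ℕ} (i j : Fin N) (n : ℕ)
    {φ : EuclideanSpace ℝ (Fin N) → ℝ} (h : ContDiff ℝ ∞ φ) :
    (partialDeriv i)^[n] (partialDeriv j φ) = partialDeriv j ((partialDeriv i)^[n] φ) := by
  induction n with
  | zero => rfl
  | succ n ih =>
    rw [Function.iterate_succ_apply', ih, Function.iterate_succ_apply',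
      partialDeriv_comm _ _ (h.partialDeriv_iterate i n)]

theorem contDiff_foldr_partialDeriv {N : ℕ} (l : List (Fin N)) (α : Fin N → ℕ)
    {φ : EuclideanSpace ℝ (Fin N) → ℝ} (h : ContDiff ℝ ∞ φ) :
    ContDiff ℝ ∞ (l.foldr (fun i h => (partialDeriv i)^[α i] h) φ) := by
  induction l with
  | nil => exact h
  | cons i l ih => exact ih.partialDeriv_iterate i _

/-- The partial product `∏_{i ∈ l} ∂_i^{α_i}` of `multiDeriv` commutes with `∂_j^n`. -/
theorem foldr_partialDeriv_comm {N : ℕ} (l : List (Fin N)) (α : Fin N → ℕ) (j : Fin N) (n : ℕ)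
    {φ : EuclideanSpace ℝ (Fin N) → ℝ} (h : ContDiff ℝ ∞ φ) :
    l.foldr (fun i h => (partialDeriv i)^[α i] h) ((partialDeriv j)^[n] φ)
      = (partialDeriv j)^[n] (l.foldr (fun i h => (partialDeriv i)^[α i] h) φ) := by
  induction n with
  | zero => rfl
  | succ n ihn =>
    rw [Function.iterate_succ_apply', Function.iterate_succ_apply', ← ihn]
    have h' := h.partialDeriv_iterate j n
    generalize (partialDeriv j)^[n] φ = ψ at h'
    clear ihn
    induction l with
    | nil => rfl
    | cons i l ih =>
      rw [List.foldr_cons, List.foldr_cons, ih,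
        partialDeriv_iterate_comm _ _ _ (contDiff_foldr_partialDeriv l α h')]

/-- Multi-index derivatives of smooth functions compose by adding the multi-indices. -/
theorem multiDeriv_add {N : ℕ} (α β : Fin N → ℕ) {φ : EuclideanSpace ℝ (Fin N) → ℝ}
    (h : ContDiff ℝ ∞ φ) : multiDeriv (α + β) φ = multiDeriv α (multiDeriv β φ) := by
  unfold multiDeriv
  induction List.finRange N with
  | nil => rfl
  | cons i l ih =>
    rw [List.foldr_cons, List.foldr_cons, List.foldr_cons, ih,
      foldr_partialDeriv_comm l α i (β i) (contDiff_foldr_partialDeriv l β h),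
      ← Function.iterate_add_apply, Pi.add_apply]

theorem foldr_partialDeriv_single {N : ℕ} (l : List (Fin N)) (hl : l.Nodup) (i : Fin N)
    (φ : EuclideanSpace ℝ (Fin N) → ℝ) :
    l.foldr (fun j h => (partialDeriv j)^[(Pi.single i 1 : Fin N → ℕ) j] h) φ
      = if i ∈ l then partialDeriv i φ else φ := by
  induction l with
  | nil => simp
  | cons j l ih =>
    rw [List.foldr_cons, ih hl.of_cons]
    by_cases hij : j = i
    · subst hij
      have : j ∉ l := (List.nodup_cons.1 hl).1
      simp [this]
    · have : i ≠ j := fun h => hij h.symm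
      simp [this, hij]

theorem multiDeriv_single {N : ℕ} (i : Fin N) (φ : EuclideanSpace ℝ (Fin N) → ℝ) :
    multiDeriv (Pi.single i 1) φ = partialDeriv i φ := by
  unfold multiDeriv
  rw [foldr_partialDeriv_single _ (List.nodup_finRange N)]
  simp

theorem multiDeriv_zero {N : ℕ} (φ : EuclideanSpace ℝ (Fin N) → ℝ) :
    multiDeriv 0 φ = φ := by
  unfold multiDeriv
  induction List.finRange N with
  | nil => rfl
  | cons i l ih => rw [List.foldr_cons, ih]; rfl

theorem partialDeriv_sum {N : ℕ} {ι : Type*} (s : Finset ι) (i : Fin N)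
    {φ : ι → EuclideanSpace ℝ (Fin N) → ℝ} (h : ∀ a, ContDiff ℝ ∞ (φ a)) :
    partialDeriv i (fun w => ∑ a ∈ s, φ a w) = fun w => ∑ a ∈ s, partialDeriv i (φ a) w := by
  funext w
  unfold partialDeriv
  rw [fderiv_fun_sum fun a _ => ((h a).differentiable (by simp)).differentiableAt]
  simp

theorem multiDeriv_sum {N : ℕ} {ι : Type*} (s : Finset ι) (α : Fin N → ℕ)
    {φ : ι → EuclideanSpace ℝ (Fin N) → ℝ} (h : ∀ a, ContDiff ℝ ∞ (φ a)) :
    multiDeriv α (fun w => ∑ a ∈ s, φ a w) = fun w => ∑ a ∈ s, multiDeriv α (φ a) w := by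
  unfold multiDeriv
  induction List.finRange N with
  | nil => rfl
  | cons i l ih =>
    simp only [List.foldr_cons]
    rw [ih]
    induction α i with
    | zero => rfl
    | succ n ihn =>
      simp only [Function.iterate_succ_apply']
      rw [ihn, partialDeriv_sum s i fun a =>
        (contDiff_foldr_partialDeriv l α (h a)).partialDeriv_iterate i n]

theorem partialDeriv_const_mul_comp_affine {N : ℕ} (i : Fin N)
    {ψ : EuclideanSpace ℝ (Fin N) → ℝ} (h : ContDiff ℝ ∞ ψ) (c t : ℝ)
    (x : EuclideanSpace ℝ (Fin N)) :
    partialDeriv i (fun z => c * ψ (t⁻¹ • (z - x)))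
      = fun z => (t⁻¹ * c) * partialDeriv i ψ (t⁻¹ • (z - x)) := by
  funext z
  have h1 : HasFDerivAt (fun z : EuclideanSpace ℝ (Fin N) => t⁻¹ • (z - x))
      (t⁻¹ • ContinuousLinearMap.id ℝ _) z := ((hasFDerivAt_id z).sub_const x).const_smul t⁻¹
  have h2 := (((h.differentiable (by simp)).differentiableAt
    (x := t⁻¹ • (z - x))).hasFDerivAt.comp z h1).const_mul c
  have h3 : HasFDerivAt (fun z => c * ψ (t⁻¹ • (z - x))) _ z := h2
  unfold partialDeriv
  rw [h3.fderiv]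
  simp
  ring

theorem multiDeriv_comp_affine {N : ℕ} (α : Fin N → ℕ)
    {ψ : EuclideanSpace ℝ (Fin N) → ℝ} (h : ContDiff ℝ ∞ ψ) (t : ℝ)
    (x : EuclideanSpace ℝ (Fin N)) :
    multiDeriv α (fun z => ψ (t⁻¹ • (z - x)))
      = fun z => (t⁻¹) ^ (∑ i, α i) * multiDeriv α ψ (t⁻¹ • (z - x)) := by
  have key : ∀ l : List (Fin N),
      l.foldr (fun i h => (partialDeriv i)^[α i] h) (fun z => ψ (t⁻¹ • (z - x)))
      = fun z => (t⁻¹) ^ ((l.map α).sum) *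
        l.foldr (fun i h => (partialDeriv i)^[α i] h) ψ (t⁻¹ • (z - x)) := by
    intro l
    induction l with
    | nil => simp
    | cons i l ih =>
      simp only [List.foldr_cons, List.map_cons, List.sum_cons]
      rw [ih]
      induction α i with
      | zero => simp
      | succ n ihn =>
        simp only [Function.iterate_succ_apply']
        rw [ihn, partialDeriv_const_mul_comp_affine i
          ((contDiff_foldr_partialDeriv l α h).partialDeriv_iterate i n)]
        funext z
        ring
  have := key (List.finRange N)
  unfold multiDeriv
  rw [this]
  simp [Fin.sum_univ_def]

/-! ### Test functions, iterated divergences and kernels with vanishing moments -/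

/-- `φ ∈ C_c^∞(U)`. -/
structure IsTestFunction {N : ℕ} (U : Set (EuclideanSpace ℝ (Fin N)))
    (φ : EuclideanSpace ℝ (Fin N) → ℝ) : Prop where
  smooth : ContDiff ℝ ∞ φ
  compact : HasCompactSupport φ
  subset : tsupport φ ⊆ U

namespace IsTestFunction

variable {N : ℕ} {U : Set (EuclideanSpace ℝ (Fin N))} {φ ψ : EuclideanSpace ℝ (Fin N) → ℝ}

theorem of_tsupport_subset (h : IsTestFunction U φ) (hψ : ContDiff ℝ ∞ ψ)
    (hs : tsupport ψ ⊆ tsupport φ) : IsTestFunction U ψ :=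
  ⟨hψ, h.compact.of_isClosed_subset (isClosed_tsupport ψ) hs, hs.trans h.subset⟩

theorem smul_left (h : IsTestFunction U φ) {a : EuclideanSpace ℝ (Fin N) → ℝ}
    (ha : ContDiff ℝ ∞ a) : IsTestFunction U (fun w => a w * φ w) :=
  h.of_tsupport_subset (ha.mul h.smooth) (tsupport_mul_subset_right)

theorem const_mul (h : IsTestFunction U φ) (a : ℝ) : IsTestFunction U (fun w => a * φ w) :=
  h.smul_left contDiff_const

theorem add (h : IsTestFunction U φ) (h' : IsTestFunction U ψ) :
    IsTestFunction U (fun w => φ w + ψ w) :=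
  ⟨h.smooth.add h'.smooth, h.compact.add h'.compact,
    (tsupport_add φ ψ).trans (Set.union_subset h.subset h'.subset)⟩

theorem zero : IsTestFunction U (fun _ => 0) :=
  ⟨contDiff_const, HasCompactSupport.zero, by
    have : tsupport (fun _ : EuclideanSpace ℝ (Fin N) => (0 : ℝ)) = ∅ := tsupport_eq_empty_iff.2 rfl
    simp [this]⟩

theorem sum {ι : Type*} (s : Finset ι) {f : ι → EuclideanSpace ℝ (Fin N) → ℝ}
    (h : ∀ i, IsTestFunction U (f i)) : IsTestFunction U (fun w => ∑ i ∈ s, f i w) := by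
  classical
  induction s using Finset.induction_on with
  | empty => simpa using zero
  | insert a s ha ih => simpa [Finset.sum_insert ha] using (h a).add ih

theorem partialDeriv (h : IsTestFunction U φ) (i : Fin N) :
    IsTestFunction U (partialDeriv i φ) :=
  h.of_tsupport_subset (h.smooth.partialDeriv i) (tsupport_fderiv_apply_subset ℝ _)

theorem partialDeriv_iterate (h : IsTestFunction U φ) (i : Fin N) (n : ℕ) :
    IsTestFunction U ((_root_.partialDeriv i)^[n] φ) := by
  induction n with
  | zero => exact h
  | succ n ih => rw [Function.iterate_succ_apply']; exact ih.partialDeriv i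

theorem multiDeriv (h : IsTestFunction U φ) (α : Fin N → ℕ) :
    IsTestFunction U (multiDeriv α φ) := by
  unfold _root_.multiDeriv
  induction List.finRange N with
  | nil => exact h
  | cons i l ih => exact ih.partialDeriv_iterate i _

theorem integrable (h : IsTestFunction U φ) : Integrable φ :=
  h.smooth.continuous.integrable_of_hasCompactSupport h.compact

theorem integral_partialDeriv (h : IsTestFunction U φ) (i : Fin N) :
    ∫ w, _root_.partialDeriv i φ w = 0 := by
  have h0 : Integrable (fun w => fderiv ℝ φ w (EuclideanSpace.single i (1 : ℝ))) volume :=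
    (h.partialDeriv i).integrable
  have h1 := integral_mul_fderiv_eq_neg_fderiv_mul_of_integrable (μ := volume)
    (f := fun _ : EuclideanSpace ℝ (Fin N) => (1 : ℝ)) (g := φ)
    (v := EuclideanSpace.single i (1 : ℝ)) (by simp) (by simpa using h0)
    (by simpa using h.integrable) (by fun_prop) fun x _ => (h.smooth.differentiable (by simp)) x
  simpa [_root_.partialDeriv] using h1

end IsTestFunction

/-- The `j`-fold divergences `∑ ∂_{i₁} ⋯ ∂_{i_j} ψ_{i₁ … i_j}` with `ψ_{i₁ … i_j} ∈ C_c^∞(U)`. -/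
def IsIteratedDivergence {N : ℕ} (U : Set (EuclideanSpace ℝ (Fin N))) :
    ℕ → (EuclideanSpace ℝ (Fin N) → ℝ) → Prop
  | 0, φ => IsTestFunction U φ
  | j + 1, φ => ∃ ψ : Fin N → EuclideanSpace ℝ (Fin N) → ℝ,
      (∀ i, IsIteratedDivergence U j (ψ i)) ∧ φ = fun w => ∑ i, partialDeriv i (ψ i) w

namespace IsIteratedDivergence

variable {N : ℕ} {U : Set (EuclideanSpace ℝ (Fin N))}

theorem isTestFunction {j : ℕ} : ∀ {φ : EuclideanSpace ℝ (Fin N) → ℝ},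
    IsIteratedDivergence U j φ → IsTestFunction U φ := by
  induction j with
  | zero => exact fun h => h
  | succ j ih =>
    rintro φ ⟨ψ, hψ, rfl⟩
    exact IsTestFunction.sum _ fun i => (ih (hψ i)).partialDeriv i

theorem pred {j : ℕ} : ∀ {φ : EuclideanSpace ℝ (Fin N) → ℝ},
    IsIteratedDivergence U (j + 1) φ → IsIteratedDivergence U j φ := by
  induction j with
  | zero => exact fun h => h.isTestFunction
  | succ j ih =>
    rintro φ ⟨ψ, hψ, rfl⟩
    exact ⟨ψ, fun i => ih (hψ i), rfl⟩

theorem of_le {j k : ℕ} (hjk : j ≤ k) {φ : EuclideanSpace ℝ (Fin N) → ℝ}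
    (h : IsIteratedDivergence U k φ) : IsIteratedDivergence U j φ := by
  induction k, hjk using Nat.le_induction with
  | base => exact h
  | succ k _ ih => exact ih h.pred

theorem const_mul {j : ℕ} (c : ℝ) : ∀ {φ : EuclideanSpace ℝ (Fin N) → ℝ},
    IsIteratedDivergence U j φ → IsIteratedDivergence U j (fun w => c * φ w) := by
  induction j with
  | zero => exact fun h => IsTestFunction.const_mul h c
  | succ j ih =>
    rintro _ ⟨ψ, hψ, rfl⟩
    refine ⟨fun i w => c * ψ i w, fun i => ih (hψ i), ?_⟩
    funext w
    rw [Finset.mul_sum]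
    refine Finset.sum_congr rfl fun i _ => ?_
    unfold partialDeriv
    rw [fderiv_const_mul
      ((hψ i).isTestFunction.smooth.differentiable (by simp)).differentiableAt]
    rfl

theorem integral_eq_zero {j : ℕ} {φ : EuclideanSpace ℝ (Fin N) → ℝ}
    (h : IsIteratedDivergence U (j + 1) φ) : ∫ w, φ w = 0 := by
  obtain ⟨ψ, hψ, rfl⟩ := h
  rw [integral_finsetSum _ fun i _ => ((hψ i).isTestFunction.partialDeriv i).integrable]
  exact Finset.sum_eq_zero fun i _ => (hψ i).isTestFunction.integral_partialDeriv i

end IsIteratedDivergence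

/-- The operator `φ ↦ div (w φ(w)) = N φ + w · ∇φ`. -/
def eulerDivergence {N : ℕ} (φ : EuclideanSpace ℝ (Fin N) → ℝ) : EuclideanSpace ℝ (Fin N) → ℝ :=
  fun w => ∑ i, partialDeriv i (fun v => v i * φ v) w

theorem contDiff_coord {N : ℕ} (i : Fin N) :
    ContDiff ℝ ∞ (fun v : EuclideanSpace ℝ (Fin N) => v i) :=
  (EuclideanSpace.proj (𝕜 := ℝ) i).contDiff

theorem sum_coord_smul_single {N : ℕ} (w : EuclideanSpace ℝ (Fin N)) :
    ∑ i, w i • EuclideanSpace.single i (1 : ℝ) = w := by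
  ext j
  simp [Pi.single_apply]

theorem eulerDivergence_apply {N : ℕ} {φ : EuclideanSpace ℝ (Fin N) → ℝ}
    (h : ContDiff ℝ ∞ φ) (w : EuclideanSpace ℝ (Fin N)) :
    eulerDivergence φ w = N * φ w + fderiv ℝ φ w w := by
  have h1 : ∀ i, partialDeriv i (fun v => v i * φ v) w
      = φ w + w i * fderiv ℝ φ w (EuclideanSpace.single i (1 : ℝ)) := by
    intro i
    have hc : HasFDerivAt (fun v : EuclideanSpace ℝ (Fin N) => v i)
        (EuclideanSpace.proj (𝕜 := ℝ) i : EuclideanSpace ℝ (Fin N) →L[ℝ] ℝ) w :=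
      (EuclideanSpace.proj (𝕜 := ℝ) i).hasFDerivAt
    unfold partialDeriv
    have hm : HasFDerivAt (fun v : EuclideanSpace ℝ (Fin N) => v i * φ v) _ w :=
      hc.mul ((h.differentiable (by simp)).differentiableAt (x := w)).hasFDerivAt
    rw [hm.fderiv]
    simp
    ring
  unfold eulerDivergence
  simp_rw [h1]
  rw [Finset.sum_add_distrib]
  congr 1
  · simp
  · conv_rhs => rw [← sum_coord_smul_single w, map_sum]
    simp_rw [sum_coord_smul_single]
    simp

theorem eulerDivergence_partialDeriv {N : ℕ} (i : Fin N) {ψ : EuclideanSpace ℝ (Fin N) → ℝ}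
    (h : ContDiff ℝ ∞ ψ) (w : EuclideanSpace ℝ (Fin N)) :
    eulerDivergence (partialDeriv i ψ) w + partialDeriv i ψ w
      = partialDeriv i (eulerDivergence ψ) w := by
  have h0 : eulerDivergence ψ = fun w => N * ψ w + fderiv ℝ ψ w w :=
    funext fun w => eulerDivergence_apply h w
  have hd : HasFDerivAt (fderiv ℝ ψ) (fderiv ℝ (fderiv ℝ ψ) w) w :=
    (((h.fderiv_right (m := ∞) (by simp)).differentiable (by simp)).differentiableAt).hasFDerivAt
  have h1 := (((h.differentiable (by simp)).differentiableAt (x := w)).hasFDerivAt.const_mul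
    (N : ℝ)).add (hd.clm_apply (hasFDerivAt_id w))
  have h2 : HasFDerivAt (fun w => N * ψ w + fderiv ℝ ψ w w) _ w := h1
  rw [eulerDivergence_apply (h.partialDeriv i), fderiv_partialDeriv_apply i h,
    fderiv_fderiv_symm h, h0]
  unfold partialDeriv
  rw [h2.fderiv]
  simp
  ring

theorem IsTestFunction.eulerDivergence {N : ℕ} {U : Set (EuclideanSpace ℝ (Fin N))}
    {φ : EuclideanSpace ℝ (Fin N) → ℝ} (h : IsTestFunction U φ) :
    IsTestFunction U (eulerDivergence φ) :=
  IsTestFunction.sum _ fun i => (h.smul_left (contDiff_coord i)).partialDeriv i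

/-- The commutator identity `[E, ∂_i] = -∂_i` for `E = N + w · ∇` makes `E + j` raise the order
of an iterated divergence by one. -/
theorem IsIteratedDivergence.eulerDivergence_add {N : ℕ} {U : Set (EuclideanSpace ℝ (Fin N))}
    {j : ℕ} : ∀ {φ : EuclideanSpace ℝ (Fin N) → ℝ}, IsIteratedDivergence U j φ →
    IsIteratedDivergence U (j + 1) (fun w => eulerDivergence φ w + j * φ w) := by
  induction j with
  | zero =>
    intro φ h
    refine ⟨fun i v => v i * φ v, fun i => IsTestFunction.smul_left h (contDiff_coord i), ?_⟩
    funext w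
    simp [eulerDivergence]
  | succ j ih =>
    rintro _ ⟨ψ, hψ, rfl⟩
    have hs : ∀ i, ContDiff ℝ ∞ (ψ i) := fun i => (hψ i).isTestFunction.smooth
    refine ⟨_, fun i => ih (hψ i), ?_⟩
    funext w
    have h1 : eulerDivergence (fun w => ∑ i, partialDeriv i (ψ i) w) w
        = ∑ i, eulerDivergence (partialDeriv i (ψ i)) w := by
      rw [eulerDivergence_apply (ContDiff.sum fun i _ => (hs i).partialDeriv i),
        fderiv_fun_sum fun i _ =>
          (((hs i).partialDeriv i).differentiable (by simp)).differentiableAt]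
      simp_rw [eulerDivergence_apply ((hs _).partialDeriv _)]
      simp [Finset.sum_add_distrib, Finset.mul_sum]
    rw [h1, Finset.mul_sum, ← Finset.sum_add_distrib]
    refine Finset.sum_congr rfl fun i _ => ?_
    have h2 : partialDeriv i (fun w => eulerDivergence (ψ i) w + j * ψ i w) w
        = partialDeriv i (eulerDivergence (ψ i)) w + j * partialDeriv i (ψ i) w := by
      have hE := (hψ i).isTestFunction.eulerDivergence.smooth
      unfold partialDeriv
      rw [fderiv_fun_add (hE.differentiable (by simp)).differentiableAt
          ((((hs i).differentiable (by simp)).differentiableAt).const_mul _),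
        fderiv_const_mul ((hs i).differentiable (by simp)).differentiableAt]
      rfl
    rw [h2, ← eulerDivergence_partialDeriv i (hs i)]
    push_cast
    ring

/-- There are test functions `K` of integral one for which `div (w K)` is a `(k + 1)`-fold
divergence; equivalently, the moments of `K` of orders `1, …, k` vanish. -/
theorem exists_kernel {N : ℕ} {U : Set (EuclideanSpace ℝ (Fin N))} (hU : IsOpen U)
    (hne : U.Nonempty) (k : ℕ) : ∃ K : EuclideanSpace ℝ (Fin N) → ℝ,
      IsTestFunction U K ∧ ∫ w, K w = 1 ∧ IsIteratedDivergence U (k + 1) (eulerDivergence K) := by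
  induction k with
  | zero =>
    obtain ⟨e, he⟩ := hne
    obtain ⟨ε, hε, hεU⟩ := Metric.isOpen_iff.1 hU e he
    let b : ContDiffBump e := ⟨ε / 4, ε / 2, by positivity, by linarith⟩
    have hb : IsTestFunction U (b.normed volume) := by
      refine ⟨b.contDiff_normed, b.hasCompactSupport_normed, ?_⟩
      rw [b.tsupport_normed_eq]
      exact (Metric.closedBall_subset_ball (by change ε / 2 < ε; linarith)).trans hεU
    refine ⟨b.normed volume, hb, b.integral_normed, ?_⟩
    have := IsIteratedDivergence.eulerDivergence_add (j := 0) (U := U) hb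
    simpa using this
  | succ k ih =>
    obtain ⟨K, hK, hK1, hE⟩ := ih
    have hEK := hK.eulerDivergence
    have hc : ((k : ℝ) + 1) ≠ 0 := by positivity
    refine ⟨fun w => K w + ((k : ℝ) + 1)⁻¹ * eulerDivergence K w,
      hK.add (hEK.const_mul _), ?_, ?_⟩
    · rw [integral_add hK.integrable (hEK.const_mul _).integrable, integral_const_mul,
        hE.integral_eq_zero, hK1]
      simp
    · have h1 := (hE.eulerDivergence_add).const_mul ((k : ℝ) + 1)⁻¹
      convert h1 using 1
      funext w
      have hS := hEK.const_mul ((k : ℝ) + 1)⁻¹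
      rw [eulerDivergence_apply (hK.add hS).smooth,
        fderiv_fun_add (hK.smooth.differentiable (by simp)).differentiableAt
          (hS.smooth.differentiable (by simp)).differentiableAt,
        fderiv_const_mul (hEK.smooth.differentiable (by simp)).differentiableAt,
        eulerDivergence_apply hEK.smooth]
      have h2 := eulerDivergence_apply hK.smooth w
      push_cast
      simp only [Pi.add_apply, Pi.smul_apply, smul_eq_mul]
      rw [mul_add, mul_add, ← mul_assoc _ ((k : ℝ) + 1), inv_mul_cancel₀ hc, one_mul, mul_add]
      rw [h2]
      ring

/-! ### Pairing Sobolev functions with rescaled test functions -/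

theorem abs_integral_mul_le_norm_mul_sqrt {X : Type*} [MeasurableSpace X] {ν : Measure X}
    (h : Lp ℝ 2 ν) {φ : X → ℝ} (hφ : MemLp φ 2 ν) :
    |∫ x, h x * φ x ∂ν| ≤ ‖h‖ * √(∫ x, φ x ^ 2 ∂ν) := by
  have h1 : inner ℝ (hφ.toLp φ) h = ∫ x, h x * φ x ∂ν := by
    rw [L2.inner_def]
    refine integral_congr_ae ?_
    filter_upwards [hφ.coeFn_toLp] with x hx
    simp [hx]
  have h2 : ‖hφ.toLp φ‖ ^ 2 = ∫ x, φ x ^ 2 ∂ν := by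
    rw [← real_inner_self_eq_norm_sq, L2.inner_def]
    refine integral_congr_ae ?_
    filter_upwards [hφ.coeFn_toLp] with x hx
    simp [hx, sq]
  rw [← h1, ← h2, Real.sqrt_sq (norm_nonneg _), mul_comm]
  exact abs_real_inner_le_norm _ _

theorem integral_comp_inv_smul_sub {N : ℕ} (ψ : EuclideanSpace ℝ (Fin N) → ℝ) {t : ℝ} (ht : 0 < t)
    (x : EuclideanSpace ℝ (Fin N)) :
    ∫ z, ψ (t⁻¹ • (z - x)) = t ^ N * ∫ w, ψ w := by
  rw [integral_sub_right_eq_self (fun z => ψ (t⁻¹ • z)) x,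
    Measure.integral_comp_inv_smul_of_nonneg _ _ ht.le]
  simp

theorem IsTestFunction.comp_inv_smul_sub {N : ℕ} {U Ω : Set (EuclideanSpace ℝ (Fin N))}
    {ψ : EuclideanSpace ℝ (Fin N) → ℝ} (h : IsTestFunction U ψ) {t : ℝ} (ht : 0 < t)
    {x : EuclideanSpace ℝ (Fin N)} (hx : ∀ w ∈ U, x + t • w ∈ Ω) :
    IsTestFunction Ω (fun z => ψ (t⁻¹ • (z - x))) := by
  let T : EuclideanSpace ℝ (Fin N) ≃ₜ EuclideanSpace ℝ (Fin N) :=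
    (Homeomorph.subRight x).trans (Homeomorph.smulOfNeZero t⁻¹ (inv_ne_zero ht.ne'))
  have hT : (fun z => ψ (t⁻¹ • (z - x))) = ψ ∘ T := rfl
  refine ⟨h.smooth.comp (by fun_prop), ?_, ?_⟩
  · rw [hT]
    exact h.compact.comp_homeomorph T
  · rw [hT, tsupport_comp_eq_preimage ψ T]
    intro z hz
    have h1 := hx _ (h.subset hz)
    have h2 : x + t • T z = z := by
      change x + t • (t⁻¹ • (z - x)) = z
      rw [smul_smul, mul_inv_cancel₀ ht.ne', one_smul, add_sub_cancel]
    rwa [h2] at h1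

theorem IsTestFunction.setIntegral_mul {N : ℕ} {Ω : Set (EuclideanSpace ℝ (Fin N))}
    {ψ : EuclideanSpace ℝ (Fin N) → ℝ} (h : IsTestFunction Ω ψ)
    (g : EuclideanSpace ℝ (Fin N) → ℝ) : ∫ z in Ω, g z * ψ z = ∫ z, g z * ψ z := by
  refine setIntegral_eq_integral_of_forall_compl_eq_zero fun z hz => ?_
  rw [image_eq_zero_of_notMem_tsupport fun h' => hz (h.subset h'), mul_zero]

theorem IsTestFunction.setIntegral {N : ℕ} {Ω : Set (EuclideanSpace ℝ (Fin N))}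
    {ψ : EuclideanSpace ℝ (Fin N) → ℝ} (h : IsTestFunction Ω ψ) :
    ∫ z in Ω, ψ z = ∫ z, ψ z := by
  simpa using h.setIntegral_mul (fun _ => 1)

theorem IsTestFunction.setIntegral_sq {N : ℕ} {Ω : Set (EuclideanSpace ℝ (Fin N))}
    {ψ : EuclideanSpace ℝ (Fin N) → ℝ} (h : IsTestFunction Ω ψ) :
    ∫ z in Ω, ψ z ^ 2 = ∫ z, ψ z ^ 2 := by
  simpa [sq] using h.setIntegral_mul ψ

/-- `‖f‖_{L²} ≤ M`, and every weak derivative of `f` of order `k` exists and has `L²` norm and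
Slobodeckij seminorm of order `σ` at most `M`. -/
structure SobolevBound {N : ℕ} (Ω : Set (EuclideanSpace ℝ (Fin N))) (k : ℕ) (σ : ℝ)
    (f : Lp ℝ 2 (volume.restrict Ω)) (M : ℝ) : Prop where
  norm_le : ‖f‖ ≤ M
  top : ∀ α : Fin N → ℕ, ∑ i, α i = k → ∃ h : Lp ℝ 2 (volume.restrict Ω),
    HasWeakDeriv Ω α f h ∧ ‖h‖ ≤ M ∧ ∃ G, IsDifferenceQuotient σ h G ∧ ‖G‖ ≤ M

theorem integral_prod_sub_mul {X : Type*} [MeasurableSpace X] {ν : Measure X} [SFinite ν]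
    {h ψ θ : X → ℝ} (h1 : Integrable (fun x => h x * ψ x) ν) (h2 : Integrable ψ ν)
    (h3 : Integrable (fun x => h x * θ x) ν) (h4 : Integrable θ ν) :
    ∫ p, (h p.1 - h p.2) * (ψ p.1 * θ p.2) ∂(ν.prod ν)
      = (∫ x, h x * ψ x ∂ν) * (∫ x, θ x ∂ν) - (∫ x, ψ x ∂ν) * ∫ x, h x * θ x ∂ν := by
  rw [← integral_prod_mul, ← integral_prod_mul, ← integral_sub (h1.mul_prod h4) (h2.mul_prod h3)]
  refine integral_congr_ae (Eventually.of_forall fun p => ?_)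
  simp only
  ring

/-- A function of vanishing mean supported in a ball of radius `ρ t` sees only the oscillation of
`h`, which the Slobodeckij seminorm of order `σ` controls. -/
theorem abs_setIntegral_mul_le_of_meanZero {N : ℕ} {Ω : Set (EuclideanSpace ℝ (Fin N))}
    {e : EuclideanSpace ℝ (Fin N)} {ρ : ℝ} (hρ : 0 < ρ) {σ : ℝ} (hσ : 0 ≤ σ)
    {ψ : EuclideanSpace ℝ (Fin N) → ℝ} (hψ : IsTestFunction (Metric.ball e ρ) ψ)
    (hψ0 : ∫ w, ψ w = 0) :
    ∃ C : ℝ, 0 ≤ C ∧ ∀ (t : ℝ) (x : EuclideanSpace ℝ (Fin N)), 0 < t →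
      (∀ w ∈ Metric.ball e ρ, x + t • w ∈ Ω) →
      ∀ (h : Lp ℝ 2 (volume.restrict Ω)) (M : ℝ), ‖h‖ ≤ M →
      (∃ G, IsDifferenceQuotient σ h G ∧ ‖G‖ ≤ M) →
      |∫ z in Ω, h z * ψ (t⁻¹ • (z - x))| ≤ C * M * t ^ (σ + (N : ℝ) / 2) := by
  have hsq : ∀ {φ : EuclideanSpace ℝ (Fin N) → ℝ}, IsTestFunction (Metric.ball e ρ) φ →
      ∀ {t : ℝ} {x : EuclideanSpace ℝ (Fin N)}, 0 < t →
      (∀ w ∈ Metric.ball e ρ, x + t • w ∈ Ω) →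
      ∫ z in Ω, φ (t⁻¹ • (z - x)) ^ 2 = t ^ N * ∫ w, φ w ^ 2 := by
    intro φ hφ t x ht hx
    rw [(hφ.comp_inv_smul_sub ht hx).setIntegral_sq]
    exact integral_comp_inv_smul_sub (fun w => φ w ^ 2) ht x
  rcases eq_or_ne σ 0 with rfl | hσ0
  · refine ⟨√(∫ w, ψ w ^ 2), Real.sqrt_nonneg _, fun t x ht hx h M hM _ => ?_⟩
    have hT := hψ.comp_inv_smul_sub ht hx
    have h1 := abs_integral_mul_le_norm_mul_sqrt h
      (hT.smooth.continuous.memLp_of_hasCompactSupport (p := 2) hT.compact)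
    rw [hsq hψ ht hx, Real.sqrt_mul (by positivity)] at h1
    have h2 : √(t ^ N) = t ^ ((N : ℝ) / 2) := by
      rw [Real.sqrt_eq_rpow, ← Real.rpow_natCast, ← Real.rpow_mul ht.le]
      congr 1
      ring
    rw [h2] at h1
    refine h1.trans ?_
    rw [zero_add, mul_comm (√_) M, mul_assoc, mul_comm (√_)]
    gcongr
  · obtain ⟨θ, hθ, hθ1, -⟩ := exists_kernel (Metric.isOpen_ball (x := e) (ε := ρ))
      ⟨e, Metric.mem_ball_self hρ⟩ 0
    have ha : 0 < (N : ℝ) / 2 + σ := by positivity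
    set a : ℝ := (N : ℝ) / 2 + σ with ha_def
    refine ⟨(2 * ρ) ^ a * (√(∫ w, ψ w ^ 2) * √(∫ w, θ w ^ 2)), by positivity,
      fun t x ht hx h M hM => ?_⟩
    rintro ⟨G, hG, hGM⟩
    have hT := hψ.comp_inv_smul_sub ht hx
    have hS := hθ.comp_inv_smul_sub ht hx
    set ψt : EuclideanSpace ℝ (Fin N) → ℝ := fun z => ψ (t⁻¹ • (z - x)) with hψt
    set θt : EuclideanSpace ℝ (Fin N) → ℝ := fun z => θ (t⁻¹ • (z - x)) with hθt
    -- the integral of `ψ` vanishes and that of `θ` is one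
    have hid : (∫ z in Ω, h z * ψt z) * t ^ N
        = ∫ p, (h p.1 - h p.2) * (ψt p.1 * θt p.2) ∂((volume.restrict Ω).prod (volume.restrict Ω)) := by
      rw [integral_prod_sub_mul (integrable_mul_test h ⟨hT.smooth, hT.compact⟩)
        hT.integrable.integrableOn (integrable_mul_test h ⟨hS.smooth, hS.compact⟩)
        hS.integrable.integrableOn]
      have e1 : ∫ z in Ω, ψt z = 0 := by
        rw [hT.setIntegral, hψt, integral_comp_inv_smul_sub ψ ht, hψ0, mul_zero]
      have e2 : ∫ z in Ω, θt z = t ^ N := by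
        rw [hS.setIntegral, hθt, integral_comp_inv_smul_sub θ ht, hθ1, mul_one]
      rw [e1, e2]
      ring
    set Φ : EuclideanSpace ℝ (Fin N) × EuclideanSpace ℝ (Fin N) → ℝ :=
      fun p => ‖p.1 - p.2‖ ^ a * (ψt p.1 * θt p.2) with hΦ
    have hid2 : ∫ p, (h p.1 - h p.2) * (ψt p.1 * θt p.2) ∂((volume.restrict Ω).prod (volume.restrict Ω))
        = ∫ p, G p * Φ p ∂((volume.restrict Ω).prod (volume.restrict Ω)) := by
      refine integral_congr_ae ?_
      filter_upwards [hG.2 hσ0] with p hp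
      have : h p.1 - h p.2 = G p * ‖p.1 - p.2‖ ^ a := by
        rcases eq_or_ne p.1 p.2 with hpp | hpp
        · simp [hpp, Real.zero_rpow ha.ne']
        · have : 0 < ‖p.1 - p.2‖ ^ a :=
            Real.rpow_pos_of_pos (norm_pos_iff.2 (sub_ne_zero.2 hpp)) _
          rw [hp, div_mul_cancel₀ _ this.ne']
      rw [this, hΦ]
      ring
    have hPcomp : HasCompactSupport (fun p : EuclideanSpace ℝ (Fin N) × EuclideanSpace ℝ (Fin N) =>
        ψt p.1 * θt p.2) := by
      refine HasCompactSupport.of_support_subset_isCompact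
        (hT.compact.isCompact.prod hS.compact.isCompact) fun p hp => ?_
      exact ⟨subset_tsupport _ (left_ne_zero_of_mul hp), subset_tsupport _ (right_ne_zero_of_mul hp)⟩
    have hPcont : Continuous (fun p : EuclideanSpace ℝ (Fin N) × EuclideanSpace ℝ (Fin N) =>
        ψt p.1 * θt p.2) :=
      (hT.smooth.continuous.comp continuous_fst).mul (hS.smooth.continuous.comp continuous_snd)
    have hΦcont : Continuous Φ :=
      ((continuous_fst.sub continuous_snd).norm.rpow_const fun _ => Or.inr ha.le).mul hPcont
    have hΦcomp : HasCompactSupport Φ := hPcomp.mul_left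
    have hCS := abs_integral_mul_le_norm_mul_sqrt G
      (hΦcont.memLp_of_hasCompactSupport (p := 2) hΦcomp)
    have hdist : ∀ p, Φ p ^ 2 ≤ ((2 * ρ * t) ^ a) ^ 2 * (ψt p.1 ^ 2 * θt p.2 ^ 2) := by
      intro p
      by_cases hp : ψt p.1 * θt p.2 = 0
      · rw [hΦ]
        simp only [hp]
        rw [mul_zero, zero_pow two_ne_zero]
        positivity
      · have m1 := hψ.subset (subset_tsupport _ (left_ne_zero_of_mul hp))
        have m2 := hθ.subset (subset_tsupport _ (right_ne_zero_of_mul hp))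
        have m3 : dist (t⁻¹ • (p.1 - x)) (t⁻¹ • (p.2 - x)) ≤ 2 * ρ := by
          have := dist_triangle_right (t⁻¹ • (p.1 - x)) (t⁻¹ • (p.2 - x)) e
          rw [Metric.mem_ball] at m1 m2
          linarith
        have m4 : ‖p.1 - p.2‖ ≤ 2 * ρ * t := by
          rw [dist_eq_norm, ← smul_sub, norm_smul, sub_sub_sub_cancel_right, norm_inv,
            Real.norm_of_nonneg ht.le] at m3
          rwa [inv_mul_le_iff₀ ht, mul_comm] at m3
        rw [hΦ]
        simp only
        rw [mul_pow, mul_pow]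
        gcongr
    have hint : ∫ p, Φ p ^ 2 ∂((volume.restrict Ω).prod (volume.restrict Ω))
        ≤ ((2 * ρ * t) ^ a) ^ 2 * ((t ^ N * ∫ w, ψ w ^ 2) * (t ^ N * ∫ w, θ w ^ 2)) := by
      rw [← hsq hψ ht hx, ← hsq hθ ht hx, ← integral_prod_mul, ← integral_const_mul]
      refine integral_mono ?_ ?_ hdist
      · exact (hΦcont.pow 2).integrable_of_hasCompactSupport
          (by simpa [sq] using hΦcomp.mul_left)
      · refine Continuous.integrable_of_hasCompactSupport ?_ ?_
        · exact continuous_const.mul (((hT.smooth.continuous.comp continuous_fst).pow 2).mul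
            ((hS.smooth.continuous.comp continuous_snd).pow 2))
        · refine HasCompactSupport.mul_left ?_
          convert hPcomp.mul_left (f := fun p => ψt p.1 * θt p.2) using 1
          funext p
          simp only [Pi.mul_apply]
          ring
    have hsqrt : √(∫ p, Φ p ^ 2 ∂((volume.restrict Ω).prod (volume.restrict Ω)))
        ≤ (2 * ρ * t) ^ a * (t ^ N * (√(∫ w, ψ w ^ 2) * √(∫ w, θ w ^ 2))) := by
      refine (Real.sqrt_le_sqrt hint).trans (le_of_eq ?_)
      have i1 : 0 ≤ ∫ w, ψ w ^ 2 := integral_nonneg fun _ => sq_nonneg _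
      have i2 : 0 ≤ ∫ w, θ w ^ 2 := integral_nonneg fun _ => sq_nonneg _
      have e1 : ((2 * ρ * t) ^ a) ^ 2 * ((t ^ N * ∫ w, ψ w ^ 2) * (t ^ N * ∫ w, θ w ^ 2))
          = ((2 * ρ * t) ^ a * t ^ N) ^ 2 * ((∫ w, ψ w ^ 2) * ∫ w, θ w ^ 2) := by ring
      rw [e1, Real.sqrt_mul (sq_nonneg _), Real.sqrt_sq (by positivity), Real.sqrt_mul i1]
      ring
    have hfin : |∫ z in Ω, h z * ψt z| * t ^ N
        ≤ M * ((2 * ρ * t) ^ a * (t ^ N * (√(∫ w, ψ w ^ 2) * √(∫ w, θ w ^ 2)))) := by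
      have htN : |t ^ N| = t ^ N := abs_of_pos (by positivity)
      rw [← htN, ← abs_mul, htN, hid, hid2]
      exact hCS.trans (mul_le_mul hGM hsqrt (Real.sqrt_nonneg _) ((norm_nonneg _).trans hGM))
    have htN : 0 < t ^ N := by positivity
    refine le_of_mul_le_mul_right (hfin.trans (le_of_eq ?_)) htN
    rw [Real.mul_rpow (by positivity) ht.le, add_comm σ]
    ring

/-- The pairing of `f` with a rescaled `(k + 1)`-fold divergence gains `k + σ` powers of the scale:
`k` derivatives are moved to `f`, and the last divergence makes the test function mean-free. -/
theorem SobolevBound.exists_pairing_bound {N : ℕ} {Ω : Set (EuclideanSpace ℝ (Fin N))}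
    {e : EuclideanSpace ℝ (Fin N)} {ρ : ℝ} (hρ : 0 < ρ) {σ : ℝ} (hσ : 0 ≤ σ) (k j : ℕ) :
    ∀ {φ : EuclideanSpace ℝ (Fin N) → ℝ} (α : Fin N → ℕ),
    IsIteratedDivergence (Metric.ball e ρ) (j + 1) φ → ∑ i, α i + j = k →
    ∃ C : ℝ, 0 ≤ C ∧ ∀ (t : ℝ) (x : EuclideanSpace ℝ (Fin N)), 0 < t →
      (∀ w ∈ Metric.ball e ρ, x + t • w ∈ Ω) →
      ∀ (f : Lp ℝ 2 (volume.restrict Ω)) (M : ℝ), SobolevBound Ω k σ f M →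
      |∫ z in Ω, f z * multiDeriv α φ (t⁻¹ • (z - x))|
        ≤ C * M * t ^ ((k : ℝ) + σ + (N : ℝ) / 2) := by
  induction j with
  | zero =>
    intro φ α hφ hα
    rw [add_zero] at hα
    obtain ⟨C, hC, H⟩ := abs_setIntegral_mul_le_of_meanZero (Ω := Ω) hρ hσ hφ.isTestFunction
      hφ.integral_eq_zero
    refine ⟨C, hC, fun t x ht hx f M hf => ?_⟩
    obtain ⟨h, hw, hM, hG⟩ := hf.top α hα
    have hT := hφ.isTestFunction.comp_inv_smul_sub ht hx
    have h1 := hw _ hT.smooth hT.compact hT.subset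
    rw [multiDeriv_comp_affine α hφ.isTestFunction.smooth, hα] at h1
    have h2 : ∫ z in Ω, f z * multiDeriv α φ (t⁻¹ • (z - x))
        = t ^ k * ((-1) ^ k * ∫ z in Ω, h z * φ (t⁻¹ • (z - x))) := by
      rw [← h1, ← integral_const_mul]
      refine integral_congr_ae (Eventually.of_forall fun z => ?_)
      have : t ^ k * t⁻¹ ^ k = 1 := by rw [← mul_pow, mul_inv_cancel₀ ht.ne', one_pow]
      simp only
      linear_combination (-(f z * multiDeriv α φ (t⁻¹ • (z - x)))) * this
    rw [h2, abs_mul, abs_mul, abs_pow, abs_pow, abs_neg, abs_one, one_pow, one_mul, abs_of_pos ht]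
    calc t ^ k * |∫ z in Ω, h z * φ (t⁻¹ • (z - x))|
        ≤ t ^ k * (C * M * t ^ (σ + (N : ℝ) / 2)) := by gcongr; exact H t x ht hx h M hM hG
      _ = C * M * t ^ ((k : ℝ) + σ + (N : ℝ) / 2) := by
        rw [add_assoc (k : ℝ), Real.rpow_add ht (k : ℝ), Real.rpow_natCast]
        ring
  | succ j ih =>
    rintro _ α ⟨ψ, hψ, rfl⟩ hα
    have hsum : ∀ i, ∑ l, (α + Pi.single i 1 : Fin N → ℕ) l + j = k := by
      intro i
      simp only [Pi.add_apply, Finset.sum_add_distrib]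
      rw [Finset.sum_pi_single']
      simp
      omega
    choose C hC H using fun i => ih (α + Pi.single i 1) (hψ i) (hsum i)
    refine ⟨∑ i, C i, Finset.sum_nonneg fun i _ => hC i, fun t x ht hx f M hf => ?_⟩
    have hs : ∀ i, ContDiff ℝ ∞ (ψ i) := fun i => (hψ i).isTestFunction.smooth
    have h1 : multiDeriv α (fun w => ∑ i, partialDeriv i (ψ i) w)
        = fun w => ∑ i, multiDeriv (α + Pi.single i 1) (ψ i) w := by
      rw [multiDeriv_sum _ _ fun i => (hs i).partialDeriv i]
      funext w
      refine Finset.sum_congr rfl fun i _ => ?_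
      rw [multiDeriv_add _ _ (hs i), multiDeriv_single]
    have hT : ∀ i, IsTestFunction Ω
        (fun z => multiDeriv (α + Pi.single i 1) (ψ i) (t⁻¹ • (z - x))) := fun i =>
      ((hψ i).isTestFunction.multiDeriv _).comp_inv_smul_sub ht hx
    rw [h1]
    simp_rw [Finset.mul_sum]
    rw [integral_finsetSum _ fun i _ => integrable_mul_test f ⟨(hT i).smooth, (hT i).compact⟩,
      Finset.sum_mul, Finset.sum_mul]
    exact (Finset.abs_sum_le_sum_abs _ _).trans
      (Finset.sum_le_sum fun i _ => H i t x ht hx f M hf)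

/-! ### Weighted means -/

/-- The weighted mean `∫_Ω f(z) t^{-N} K((z - x) / t) dz` of `f` around `x` at scale `t`. -/
def kernelAverage {N : ℕ} {Ω : Set (EuclideanSpace ℝ (Fin N))}
    (K : EuclideanSpace ℝ (Fin N) → ℝ) (f : Lp ℝ 2 (volume.restrict Ω)) (t : ℝ)
    (x : EuclideanSpace ℝ (Fin N)) : ℝ :=
  ∫ z in Ω, f z * (t⁻¹ ^ N * K (t⁻¹ • (z - x)))

theorem IsTestFunction.exists_bound {N : ℕ} {U : Set (EuclideanSpace ℝ (Fin N))}
    {φ : EuclideanSpace ℝ (Fin N) → ℝ} (h : IsTestFunction U φ) :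
    ∃ B : ℝ, 0 ≤ B ∧ ∀ w, |φ w| ≤ B := by
  obtain ⟨B, hB⟩ := h.compact.exists_bound_of_continuous h.smooth.continuous
  exact ⟨B, (norm_nonneg _).trans (hB 0), hB⟩

theorem lp_two_integrable {N : ℕ} {Ω : Set (EuclideanSpace ℝ (Fin N))}
    [IsFiniteMeasure (volume.restrict Ω)] (f : Lp ℝ 2 (volume.restrict Ω)) :
    Integrable f (volume.restrict Ω) :=
  (Lp.memLp f).integrable (by norm_num)

/-- `d/dt (t^{-N} K(y / t)) = -t^{-N-1} (E K)(y / t)` with `E φ = div (w φ)`. -/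
theorem hasDerivAt_kernelAverage_scale {N : ℕ} {U Ω : Set (EuclideanSpace ℝ (Fin N))}
    [IsFiniteMeasure (volume.restrict Ω)] {K : EuclideanSpace ℝ (Fin N) → ℝ}
    (hK : IsTestFunction U K) (f : Lp ℝ 2 (volume.restrict Ω)) {t : ℝ} (ht : 0 < t)
    (x : EuclideanSpace ℝ (Fin N)) :
    HasDerivAt (fun t => kernelAverage K f t x)
      (-(t⁻¹ ^ (N + 1)) * ∫ z in Ω, f z * eulerDivergence K (t⁻¹ • (z - x))) t := by
  obtain ⟨B, hB, hKB⟩ := hK.exists_bound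
  obtain ⟨B', hB', hEB⟩ := hK.eulerDivergence.exists_bound
  have hf := lp_two_integrable f
  have hcont : ∀ s : ℝ, Continuous fun z => s⁻¹ ^ N * K (s⁻¹ • (z - x)) := fun s =>
    continuous_const.mul (hK.smooth.continuous.comp (by fun_prop))
  have hcont' : ∀ s : ℝ, Continuous fun z => eulerDivergence K (s⁻¹ • (z - x)) := fun s =>
    hK.eulerDivergence.smooth.continuous.comp (by fun_prop)
  have hderiv : ∀ (s : ℝ), 0 < s → ∀ z, HasDerivAt
      (fun s : ℝ => f z * (s⁻¹ ^ N * K (s⁻¹ • (z - x))))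
      (f z * (-(s⁻¹ ^ (N + 1)) * eulerDivergence K (s⁻¹ • (z - x)))) s := by
    intro s hs z
    have h1 := hasDerivAt_inv hs.ne'
    have h2 : HasDerivAt (fun s : ℝ => s⁻¹ • (z - x)) (-(s ^ 2)⁻¹ • (z - x)) s :=
      h1.smul_const (z - x)
    have h3 : HasDerivAt (fun s : ℝ => K (s⁻¹ • (z - x))) _ s :=
      (((hK.smooth.differentiable (by simp)) (s⁻¹ • (z - x))).hasFDerivAt).comp_hasDerivAt s h2
    have h4 : HasDerivAt (fun s : ℝ => s⁻¹ ^ N * K (s⁻¹ • (z - x))) _ s := (h1.pow N).mul h3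
    refine (h4.const_mul (f z)).congr_deriv ?_
    rw [eulerDivergence_apply hK.smooth, map_smul, map_smul]
    simp only [smul_eq_mul, Pi.pow_apply]
    rw [← inv_pow]
    rcases N with _ | n
    · push_cast
      ring
    · simp only [Nat.cast_add, Nat.cast_one, Nat.add_sub_cancel]
      ring
  have hmain := hasDerivAt_integral_of_dominated_loc_of_deriv_le (μ := volume.restrict Ω)
    (F := fun (s : ℝ) z => f z * (s⁻¹ ^ N * K (s⁻¹ • (z - x))))
    (F' := fun (s : ℝ) z => f z * (-(s⁻¹ ^ (N + 1)) * eulerDivergence K (s⁻¹ • (z - x))))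
    (bound := fun z => |f z| * ((2 / t) ^ (N + 1) * B')) (x₀ := t)
    (Ioi_mem_nhds (half_lt_self ht))
    (Eventually.of_forall fun s => hf.aestronglyMeasurable.mul (hcont s).aestronglyMeasurable)
    (hf.mul_bdd (c := |t⁻¹ ^ N| * B) (hcont t).aestronglyMeasurable
      (Eventually.of_forall fun z => by
        rw [norm_mul, Real.norm_eq_abs, Real.norm_eq_abs]
        gcongr
        exact hKB _))
    (hf.aestronglyMeasurable.mul (continuous_const.mul (hcont' t)).aestronglyMeasurable)
    (Eventually.of_forall fun z s hs => by
      have hs0 : 0 < s := (half_pos ht).trans hs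
      have hst : s⁻¹ ≤ 2 / t := by
        rw [inv_le_comm₀ hs0 (by positivity), inv_div]
        exact (Set.mem_Ioi.1 hs).le
      rw [norm_mul, norm_mul, norm_neg, Real.norm_eq_abs, Real.norm_eq_abs, Real.norm_eq_abs,
        abs_of_pos (pow_pos (inv_pos.2 hs0) _)]
      gcongr
      exact hEB _)
    (hf.abs.mul_const _)
    (Eventually.of_forall fun z s hs => hderiv s ((half_pos ht).trans hs) z)
  rw [← integral_const_mul]
  refine hmain.2.congr_deriv (integral_congr_ae (Eventually.of_forall fun z => ?_))
  simp only
  ring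

theorem hasFDerivAt_mul_rescaled {N : ℕ} {K : EuclideanSpace ℝ (Fin N) → ℝ}
    (hK : ContDiff ℝ ∞ K) (a t : ℝ) (y z : EuclideanSpace ℝ (Fin N)) :
    HasFDerivAt (fun y => a * (t⁻¹ ^ N * K (t⁻¹ • (z - y))))
      (∑ i, (a * (-(t⁻¹ ^ (N + 1)) * partialDeriv i K (t⁻¹ • (z - y)))) •
        (EuclideanSpace.proj i : EuclideanSpace ℝ (Fin N) →L[ℝ] ℝ)) y := by
  have h1 : HasFDerivAt (fun y : EuclideanSpace ℝ (Fin N) => t⁻¹ • (z - y))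
      (t⁻¹ • (-ContinuousLinearMap.id ℝ _)) y :=
    ((hasFDerivAt_id y).const_sub z).const_smul t⁻¹
  have h2 : HasFDerivAt (fun y => a * (t⁻¹ ^ N * K (t⁻¹ • (z - y)))) _ y :=
    ((((hK.differentiable (by simp)) (t⁻¹ • (z - y))).hasFDerivAt.comp y h1).const_mul
      (t⁻¹ ^ N)).const_mul a
  refine h2.congr_fderiv (ContinuousLinearMap.ext fun v => ?_)
  have hv : fderiv ℝ K (t⁻¹ • (z - y)) v
      = ∑ i, v i * partialDeriv i K (t⁻¹ • (z - y)) := by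
    conv_lhs => rw [← sum_coord_smul_single v, map_sum]
    simp [partialDeriv]
  simp [hv, Finset.mul_sum]
  refine Finset.sum_congr rfl fun i _ => ?_
  rw [pow_succ, mul_inv]
  ring

theorem integrable_and_integral_sum_smul {ι X E : Type*} [Fintype ι] [MeasurableSpace X]
    [NormedAddCommGroup E] [NormedSpace ℝ E] [CompleteSpace E] {ν : Measure X} {a : ι → X → ℝ}
    (h : ∀ i, Integrable (a i) ν) (P : ι → E) :
    Integrable (fun z => ∑ i, a i z • P i) ν ∧
      ∫ z, ∑ i, a i z • P i ∂ν = ∑ i, (∫ z, a i z ∂ν) • P i := by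
  have h1 : ∀ i, Integrable (fun z => a i z • P i) ν := fun i => (h i).smul_const (P i)
  refine ⟨integrable_finsetSum _ fun i _ => h1 i, ?_⟩
  rw [integral_finsetSum _ fun i _ => h1 i]
  exact Finset.sum_congr rfl fun i _ => integral_smul_const _ (P i)

theorem hasFDerivAt_kernelAverage {N : ℕ} {U Ω : Set (EuclideanSpace ℝ (Fin N))}
    [IsFiniteMeasure (volume.restrict Ω)] {K : EuclideanSpace ℝ (Fin N) → ℝ}
    (hK : IsTestFunction U K) (f : Lp ℝ 2 (volume.restrict Ω)) (t : ℝ)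
    (x : EuclideanSpace ℝ (Fin N)) :
    HasFDerivAt (kernelAverage K f t)
      (∑ i, (∫ z in Ω, f z * (-(t⁻¹ ^ (N + 1)) * partialDeriv i K (t⁻¹ • (z - x)))) •
        (EuclideanSpace.proj i : EuclideanSpace ℝ (Fin N) →L[ℝ] ℝ)) x := by
  have hf := lp_two_integrable f
  obtain ⟨B, hB, hKB⟩ := hK.exists_bound
  choose B' hB' hPB using fun i => (hK.partialDeriv i).exists_bound
  have hcont : ∀ y, Continuous fun z => t⁻¹ ^ N * K (t⁻¹ • (z - y)) := fun y =>
    continuous_const.mul (hK.smooth.continuous.comp (by fun_prop))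
  have hcont' : ∀ i y, Continuous fun z => -(t⁻¹ ^ (N + 1)) * partialDeriv i K (t⁻¹ • (z - y)) :=
    fun i y => continuous_const.mul ((hK.partialDeriv i).smooth.continuous.comp (by fun_prop))
  have hint : ∀ i, Integrable
      (fun z => f z * (-(t⁻¹ ^ (N + 1)) * partialDeriv i K (t⁻¹ • (z - x))))
      (volume.restrict Ω) := fun i =>
    hf.mul_bdd (c := |(t⁻¹ ^ (N + 1))| * B' i) (hcont' i x).aestronglyMeasurable
      (Eventually.of_forall fun z => by
        rw [norm_mul, norm_neg, Real.norm_eq_abs, Real.norm_eq_abs]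
        gcongr
        exact hPB i _)
  let P : Fin N → (EuclideanSpace ℝ (Fin N) →L[ℝ] ℝ) := fun i => EuclideanSpace.proj i
  let F' : EuclideanSpace ℝ (Fin N) → EuclideanSpace ℝ (Fin N) →
      (EuclideanSpace ℝ (Fin N) →L[ℝ] ℝ) := fun y z =>
    ∑ i, (f z * (-(t⁻¹ ^ (N + 1)) * partialDeriv i K (t⁻¹ • (z - y)))) • P i
  have hint0 : Integrable (fun z => f z * (t⁻¹ ^ N * K (t⁻¹ • (z - x)))) (volume.restrict Ω) :=
    hf.mul_bdd (c := |t⁻¹ ^ N| * B) (hcont x).aestronglyMeasurable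
      (Eventually.of_forall fun z => by
        rw [norm_mul, Real.norm_eq_abs, Real.norm_eq_abs]
        gcongr
        exact hKB _)
  obtain ⟨hint', hval⟩ := integrable_and_integral_sum_smul hint P
  have hbound : ∀ z y, ‖F' y z‖ ≤ ∑ i, |f z| * (|t⁻¹ ^ (N + 1)| * B' i) * ‖P i‖ := by
    intro z y
    refine (norm_sum_le _ _).trans (Finset.sum_le_sum fun i _ => ?_)
    rw [norm_smul, norm_mul, norm_mul, norm_neg, Real.norm_eq_abs, Real.norm_eq_abs,
      Real.norm_eq_abs]
    gcongr
    exact hPB i _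
  have hbint : Integrable (fun z => ∑ i, |f z| * (|t⁻¹ ^ (N + 1)| * B' i) * ‖P i‖)
      (volume.restrict Ω) :=
    integrable_finsetSum _ fun i _ => (hf.abs.mul_const _).mul_const _
  have hmain := hasFDerivAt_integral_of_dominated_of_fderiv_le (𝕜 := ℝ) (μ := volume.restrict Ω)
    (F := fun y z => f z * (t⁻¹ ^ N * K (t⁻¹ • (z - y)))) (F' := F') (x₀ := x) univ_mem
    (Eventually.of_forall fun y => hf.aestronglyMeasurable.mul (hcont y).aestronglyMeasurable)
    hint0 hint'.aestronglyMeasurable (Eventually.of_forall fun z y _ => hbound z y) hbint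
    (Eventually.of_forall fun z y _ => hasFDerivAt_mul_rescaled hK.smooth (f z) t y z)
  refine hmain.congr_fderiv ?_
  exact hval

/-- With `hasFDerivAt_kernelAverage`: the `i`-th partial derivative of the mean of `f` is the mean
of the weak derivative `∂_i f`. -/
theorem HasWeakDeriv.setIntegral_partialDeriv_kernel {N : ℕ}
    {U Ω : Set (EuclideanSpace ℝ (Fin N))}
    {K : EuclideanSpace ℝ (Fin N) → ℝ} (hK : IsTestFunction U K)
    {f h : Lp ℝ 2 (volume.restrict Ω)} {i : Fin N} (hw : HasWeakDeriv Ω (Pi.single i 1) f h)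
    {t : ℝ} (ht : 0 < t) {x : EuclideanSpace ℝ (Fin N)} (hx : ∀ w ∈ U, x + t • w ∈ Ω) :
    ∫ z in Ω, f z * (-(t⁻¹ ^ (N + 1)) * partialDeriv i K (t⁻¹ • (z - x)))
      = kernelAverage K h t x := by
  have hT := hK.comp_inv_smul_sub ht hx
  have h1 := hw _ hT.smooth hT.compact hT.subset
  rw [multiDeriv_comp_affine _ hK.smooth, multiDeriv_single] at h1
  have hs : ∑ j, (Pi.single i 1 : Fin N → ℕ) j = 1 := by simp
  rw [hs, pow_one, pow_one] at h1
  unfold kernelAverage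
  have e1 : ∫ z in Ω, f z * (-(t⁻¹ ^ (N + 1)) * partialDeriv i K (t⁻¹ • (z - x)))
      = -(t⁻¹ ^ N) * ∫ z in Ω, f z * (t⁻¹ * partialDeriv i K (t⁻¹ • (z - x))) := by
    rw [← integral_const_mul]
    congr 1
    funext z
    ring
  have e2 : ∫ z in Ω, h z * (t⁻¹ ^ N * K (t⁻¹ • (z - x)))
      = t⁻¹ ^ N * ∫ z in Ω, h z * K (t⁻¹ • (z - x)) := by
    rw [← integral_const_mul]
    congr 1
    funext z
    ring
  rw [e1, e2, h1]
  ring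

/-- At Lebesgue points of `f`, extended by zero, the weighted means converge to `f`. -/
theorem ae_tendsto_kernelAverage {N : ℕ} {U Ω : Set (EuclideanSpace ℝ (Fin N))} (hΩ : IsOpen Ω)
    [IsFiniteMeasure (volume.restrict Ω)] {K : EuclideanSpace ℝ (Fin N) → ℝ}
    (hK : IsTestFunction U K) (hK1 : ∫ w, K w = 1) (f : Lp ℝ 2 (volume.restrict Ω)) :
    ∀ᵐ x ∂(volume.restrict Ω),
      Tendsto (fun t => kernelAverage K f t x) (𝓝[>] 0) (𝓝 (f x)) := by
  set F : EuclideanSpace ℝ (Fin N) → ℝ := Ω.indicator f with hF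
  have hFi : Integrable F := (integrable_indicator_iff hΩ.measurableSet).2 (lp_two_integrable f)
  obtain ⟨B, hB, hKB⟩ := hK.exists_bound
  obtain ⟨R, hR, hKR⟩ : ∃ R : ℝ, 0 < R ∧ ∀ w, R < ‖w‖ → K w = 0 := by
    obtain ⟨R, hR⟩ := hK.compact.isCompact.isBounded.subset_closedBall 0
    refine ⟨max R 1, by positivity, fun w hw => image_eq_zero_of_notMem_tsupport fun h => ?_⟩
    have := hR h
    rw [mem_closedBall_zero_iff] at this
    exact absurd (this.trans (le_max_left R 1)) (not_le.2 hw)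
  have hleb := IsUnifLocDoublingMeasure.ae_tendsto_average_norm_sub (μ := volume)
    hFi.locallyIntegrable 1
  rw [ae_restrict_iff' hΩ.measurableSet]
  filter_upwards [hleb] with x hx hxΩ
  have hδ : Tendsto (fun t : ℝ => R * t) (𝓝[>] 0) (𝓝[>] 0) := by
    refine tendsto_nhdsWithin_iff.2 ⟨?_, ?_⟩
    · have : Tendsto (fun t : ℝ => R * t) (𝓝 0) (𝓝 (R * 0)) := tendsto_id.const_mul R
      rw [mul_zero] at this
      exact this.mono_left nhdsWithin_le_nhds
    · filter_upwards [self_mem_nhdsWithin] with t ht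
      exact mul_pos hR ht
  have h1 := hx (fun _ => x) (fun t : ℝ => R * t) hδ (by
    filter_upwards [self_mem_nhdsWithin] with t ht
    rw [one_mul]
    exact Metric.mem_closedBall_self (mul_pos hR ht).le)
  set v := volume.real (Metric.closedBall (0 : EuclideanSpace ℝ (Fin N)) R) with hv
  have h2 := h1.const_mul (B * v)
  rw [mul_zero] at h2
  rw [tendsto_iff_norm_sub_tendsto_zero]
  refine squeeze_zero' (Eventually.of_forall fun _ => norm_nonneg _) ?_ h2
  filter_upwards [self_mem_nhdsWithin] with t ht
  have ht : 0 < t := ht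
  have htN : t⁻¹ ^ N * t ^ N = 1 := by rw [← mul_pow, inv_mul_cancel₀ ht.ne', one_pow]
  have hKc : Continuous fun z => t⁻¹ ^ N * K (t⁻¹ • (z - x)) :=
    continuous_const.mul (hK.smooth.continuous.comp (by fun_prop))
  have hKi : Integrable fun z => t⁻¹ ^ N * K (t⁻¹ • (z - x)) :=
    ((hK.comp_inv_smul_sub (Ω := Set.univ) (x := x) ht fun _ _ => trivial).integrable).const_mul _
  have hKint : ∫ z, t⁻¹ ^ N * K (t⁻¹ • (z - x)) = 1 := by
    rw [integral_const_mul, integral_comp_inv_smul_sub K ht, hK1, mul_one, htN]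
  have hKb : ∀ z, ‖t⁻¹ ^ N * K (t⁻¹ • (z - x))‖ ≤ t⁻¹ ^ N * B := fun z => by
    rw [norm_mul, Real.norm_of_nonneg (by positivity), Real.norm_eq_abs]
    gcongr
    exact hKB _
  have e1 : kernelAverage K f t x = ∫ z, F z * (t⁻¹ ^ N * K (t⁻¹ • (z - x))) := by
    unfold kernelAverage
    rw [← integral_indicator hΩ.measurableSet]
    refine integral_congr_ae (Eventually.of_forall fun z => ?_)
    by_cases hz : z ∈ Ω <;> simp [hF, hz]
  have e2 : f x = ∫ z, F x * (t⁻¹ ^ N * K (t⁻¹ • (z - x))) := by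
    rw [integral_const_mul, hKint, mul_one, hF, Set.indicator_of_mem hxΩ]
  have hFK : Integrable fun z => F z * (t⁻¹ ^ N * K (t⁻¹ • (z - x))) :=
    hFi.mul_bdd hKc.aestronglyMeasurable (Eventually.of_forall hKb)
  rw [e1, e2, ← integral_sub hFK (hKi.const_mul _)]
  have hvol : volume.real (Metric.closedBall x (R * t)) = t ^ N * v := by
    rw [hv, measureReal_def, measureReal_def, mul_comm R t,
      Measure.addHaar_closedBall_mul volume x ht.le hR.le, ENNReal.toReal_mul,
      ENNReal.toReal_ofReal (by positivity), finrank_euclideanSpace_fin]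
  have hvpos : 0 < volume.real (Metric.closedBall x (R * t)) :=
    ENNReal.toReal_pos (Metric.measure_closedBall_pos _ _ (mul_pos hR ht)).ne'
      measure_closedBall_lt_top.ne
  have hloc : Integrable (fun z => ‖F z - F x‖)
      (volume.restrict (Metric.closedBall x (R * t))) :=
    (hFi.integrableOn.sub (integrableOn_const measure_closedBall_lt_top.ne)).norm
  calc ‖∫ z, F z * (t⁻¹ ^ N * K (t⁻¹ • (z - x))) - F x * (t⁻¹ ^ N * K (t⁻¹ • (z - x)))‖
      = ‖∫ z in Metric.closedBall x (R * t),
          F z * (t⁻¹ ^ N * K (t⁻¹ • (z - x))) - F x * (t⁻¹ ^ N * K (t⁻¹ • (z - x)))‖ := by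
        rw [setIntegral_eq_integral_of_forall_compl_eq_zero]
        intro z hz
        have : R < ‖t⁻¹ • (z - x)‖ := by
          rw [Metric.mem_closedBall, not_le, dist_eq_norm] at hz
          rw [norm_smul, norm_inv, Real.norm_of_nonneg ht.le, lt_inv_mul_iff₀ ht, mul_comm]
          exact hz
        rw [hKR _ this]
        simp
    _ ≤ ∫ z in Metric.closedBall x (R * t), (t⁻¹ ^ N * B) * ‖F z - F x‖ := by
        refine norm_integral_le_of_norm_le (hloc.const_mul _) (Eventually.of_forall fun z => ?_)
        rw [← sub_mul, norm_mul, mul_comm]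
        gcongr
        exact hKb z
    _ = B * v * ⨍ z in Metric.closedBall x (R * t), ‖F z - F x‖ := by
        rw [integral_const_mul, setAverage_eq, hvol, smul_eq_mul]
        have hvne : v ≠ 0 := by
          intro h0
          rw [hvol, h0, mul_zero] at hvpos
          exact lt_irrefl _ hvpos
        rw [mul_inv, inv_pow]
        field_simp

/-! ### Convergence of the weighted means on interior cones -/

/-- Every point `x ∈ V` is the vertex of the truncated cone `{x + t w : 0 < t ≤ 1, |w - e| < ρ}`
contained in `Ω`. -/
def HasInteriorCones {N : ℕ} (Ω V : Set (EuclideanSpace ℝ (Fin N)))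
    (e : EuclideanSpace ℝ (Fin N)) (ρ : ℝ) : Prop :=
  ∀ x ∈ V, ∀ t : ℝ, 0 < t → t ≤ 1 → ∀ w ∈ Metric.ball e ρ, x + t • w ∈ Ω

theorem SobolevBound.nonneg {N : ℕ} {Ω : Set (EuclideanSpace ℝ (Fin N))} {k : ℕ} {σ : ℝ}
    {f : Lp ℝ 2 (volume.restrict Ω)} {M : ℝ} (h : SobolevBound Ω k σ f M) : 0 ≤ M :=
  (norm_nonneg _).trans h.norm_le

/-- The increments of the weighted means in the scale, from integrating
`|d/dt A_t f(x)| ≤ C M t^(γ - 1)` with `γ = k + σ - N / 2 > 0`. -/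
theorem SobolevBound.exists_kernelAverage_sub_le {N : ℕ} {Ω V : Set (EuclideanSpace ℝ (Fin N))}
    [IsFiniteMeasure (volume.restrict Ω)]
    {e : EuclideanSpace ℝ (Fin N)} {ρ : ℝ} (hρ : 0 < ρ) (hV : HasInteriorCones Ω V e ρ)
    {k : ℕ} {σ : ℝ} (hσ : 0 ≤ σ) (hγ : 0 < (k : ℝ) + σ - (N : ℝ) / 2)
    {K : EuclideanSpace ℝ (Fin N) → ℝ} (hK : IsTestFunction (Metric.ball e ρ) K)
    (hE : IsIteratedDivergence (Metric.ball e ρ) (k + 1) (eulerDivergence K)) :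
    ∃ C : ℝ, 0 ≤ C ∧ ∀ (f : Lp ℝ 2 (volume.restrict Ω)) (M : ℝ), SobolevBound Ω k σ f M →
      ∀ x ∈ V, ∀ s t : ℝ, 0 < s → s ≤ t → t ≤ 1 →
      |kernelAverage K f t x - kernelAverage K f s x|
        ≤ C * M * t ^ ((k : ℝ) + σ - (N : ℝ) / 2) := by
  obtain ⟨C, hC, H⟩ := SobolevBound.exists_pairing_bound (Ω := Ω) hρ hσ k k 0 hE (by simp)
  rw [multiDeriv_zero] at H
  set γ := (k : ℝ) + σ - (N : ℝ) / 2 with hγdef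
  refine ⟨C / γ, by positivity, fun f M hf x hx s t hs hst ht1 => ?_⟩
  have hM := hf.nonneg
  have hder : ∀ u ∈ Set.Icc s t, HasDerivAt (fun t => kernelAverage K f t x)
      (-(u⁻¹ ^ (N + 1)) * ∫ z in Ω, f z * eulerDivergence K (u⁻¹ • (z - x))) u := fun u hu =>
    hasDerivAt_kernelAverage_scale hK f (hs.trans_le hu.1) x
  have hB : ∀ u ∈ Set.Icc s t, HasDerivAt (fun u : ℝ => C * M / γ * (u ^ γ - s ^ γ))
      (C * M * u ^ (γ - 1)) u := by
    intro u hu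
    have h1 := ((Real.hasDerivAt_rpow_const (p := γ) (Or.inl (hs.trans_le hu.1).ne')).sub_const
      (s ^ γ)).const_mul (C * M / γ)
    refine h1.congr_deriv ?_
    field_simp
  have hmain := image_norm_le_of_norm_deriv_right_le_deriv_boundary' (a := s) (b := t)
    (f := fun u => kernelAverage K f u x - kernelAverage K f s x)
    (B := fun u : ℝ => C * M / γ * (u ^ γ - s ^ γ))
    (fun u hu => ((hder u hu).sub_const _).continuousAt.continuousWithinAt)
    (fun u hu => ((hder u (Set.Ico_subset_Icc_self hu)).sub_const _).hasDerivWithinAt)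
    (by simp)
    (fun u hu => (hB u hu).continuousAt.continuousWithinAt)
    (fun u hu => (hB u (Set.Ico_subset_Icc_self hu)).hasDerivWithinAt)
    (fun u hu => by
      have hu0 : 0 < u := hs.trans_le hu.1
      rw [norm_mul, norm_neg, Real.norm_of_nonneg (by positivity), Real.norm_eq_abs]
      refine (mul_le_mul_of_nonneg_left
        (H u x hu0 (hV x hx u hu0 (hu.2.le.trans ht1)) f M hf) (by positivity)).trans (le_of_eq ?_)
      have e1 : u⁻¹ ^ (N + 1) = u ^ (-((N : ℝ) + 1)) := by
        rw [Real.rpow_neg hu0.le, inv_pow, ← Real.rpow_natCast]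
        push_cast
        rfl
      have e2 : u ^ (-((N : ℝ) + 1)) * u ^ ((k : ℝ) + σ + (N : ℝ) / 2) = u ^ (γ - 1) := by
        rw [← Real.rpow_add hu0]
        congr 1
        rw [hγdef]
        ring
      rw [e1, ← e2]
      ring)
    (Set.right_mem_Icc.2 hst)
  rw [← Real.norm_eq_abs]
  refine hmain.trans ?_
  have : 0 ≤ s ^ γ := (Real.rpow_pos_of_pos hs _).le
  calc C * M / γ * (t ^ γ - s ^ γ) ≤ C * M / γ * t ^ γ := by gcongr; linarith
    _ = C / γ * M * t ^ γ := by ring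

theorem abs_kernelAverage_one_le {N : ℕ} {Ω V : Set (EuclideanSpace ℝ (Fin N))}
    {e : EuclideanSpace ℝ (Fin N)} {ρ : ℝ} (hV : HasInteriorCones Ω V e ρ)
    {K : EuclideanSpace ℝ (Fin N) → ℝ} (hK : IsTestFunction (Metric.ball e ρ) K)
    (f : Lp ℝ 2 (volume.restrict Ω)) {x : EuclideanSpace ℝ (Fin N)} (hx : x ∈ V) :
    |kernelAverage K f 1 x| ≤ √(∫ w, K w ^ 2) * ‖f‖ := by
  have hT := hK.comp_inv_smul_sub one_pos (hV x hx 1 one_pos le_rfl)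
  have h1 := abs_integral_mul_le_norm_mul_sqrt f
    (hT.smooth.continuous.memLp_of_hasCompactSupport (p := 2) hT.compact)
  rw [hT.setIntegral_sq, integral_comp_inv_smul_sub (fun w => K w ^ 2) one_pos, one_pow, one_mul,
    mul_comm] at h1
  simpa [kernelAverage] using h1

/-- The averages at scale `t → 0` converge uniformly to a continuous representative. -/
theorem SobolevBound.exists_continuous_limit {N : ℕ} {Ω V : Set (EuclideanSpace ℝ (Fin N))}
    (hΩ : IsOpen Ω) [IsFiniteMeasure (volume.restrict Ω)] (hVo : IsOpen V) (hVΩ : V ⊆ Ω)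
    {e : EuclideanSpace ℝ (Fin N)} {ρ : ℝ} (hρ : 0 < ρ) (hV : HasInteriorCones Ω V e ρ)
    {k : ℕ} {σ : ℝ} (hσ : 0 ≤ σ) (hγ : 0 < (k : ℝ) + σ - (N : ℝ) / 2)
    {K : EuclideanSpace ℝ (Fin N) → ℝ} (hK : IsTestFunction (Metric.ball e ρ) K)
    (hK1 : ∫ w, K w = 1)
    (hE : IsIteratedDivergence (Metric.ball e ρ) (k + 1) (eulerDivergence K)) :
    ∃ C : ℝ, 0 ≤ C ∧ ∀ (f : Lp ℝ 2 (volume.restrict Ω)) (M : ℝ), SobolevBound Ω k σ f M →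
      ∃ g : EuclideanSpace ℝ (Fin N) → ℝ, ContinuousOn g V ∧ g =ᵐ[volume.restrict V] f ∧
        (∀ x ∈ V, |g x| ≤ C * M) ∧
        TendstoUniformlyOn (fun (n : ℕ) x => kernelAverage K f (1 / ((n : ℝ) + 1)) x) g atTop V := by
  obtain ⟨C, hC, H⟩ := SobolevBound.exists_kernelAverage_sub_le hρ hV hσ hγ hK hE
  set γ := (k : ℝ) + σ - (N : ℝ) / 2 with hγdef
  refine ⟨√(∫ w, K w ^ 2) + C, by positivity, fun f M hf => ?_⟩
  have hM := hf.nonneg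
  set τ : ℕ → ℝ := fun n => 1 / ((n : ℝ) + 1) with hτ
  have hτ0 : ∀ n, 0 < τ n := fun n => by positivity
  have hτmono : ∀ m n, m ≤ n → τ n ≤ τ m := fun m n h =>
    one_div_le_one_div_of_le (by positivity) (by simpa using h)
  have hτ1 : ∀ n, τ n ≤ 1 := fun n => by simpa [hτ] using hτmono 0 n (Nat.zero_le n)
  have hτlim : Tendsto τ atTop (𝓝 0) := tendsto_one_div_add_atTop_nhds_zero_nat
  set b : ℕ → ℝ := fun n => C * M * τ n ^ γ with hb
  have hblim : Tendsto b atTop (𝓝 0) := by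
    have := (hτlim.rpow_const (p := γ) (Or.inr hγ.le)).const_mul (C * M)
    rwa [Real.zero_rpow hγ.ne', mul_zero] at this
  have hstep : ∀ x ∈ V, ∀ m n, m ≤ n →
      |kernelAverage K f (τ m) x - kernelAverage K f (τ n) x| ≤ b m := fun x hx m n hmn =>
    H f M hf x hx _ _ (hτ0 n) (hτmono m n hmn) (hτ1 m)
  have hcauchy : ∀ x ∈ V, ∃ l, Tendsto (fun n => kernelAverage K f (τ n) x) atTop (𝓝 l) := by
    intro x hx
    refine cauchySeq_tendsto_of_complete (cauchySeq_of_le_tendsto_0' b (fun m n hmn => ?_) hblim)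
    rw [Real.dist_eq]
    exact hstep x hx m n hmn
  choose! g hg using hcauchy
  have hlim : ∀ x ∈ V, ∀ m, |kernelAverage K f (τ m) x - g x| ≤ b m := by
    intro x hx m
    refine le_of_tendsto ((tendsto_const_nhds.sub (hg x hx)).abs) ?_
    filter_upwards [eventually_ge_atTop m] with n hn using hstep x hx m n hn
  have hunif : TendstoUniformlyOn (fun n x => kernelAverage K f (τ n) x) g atTop V := by
    rw [Metric.tendstoUniformlyOn_iff]
    intro ε hε
    filter_upwards [hblim.eventually_lt_const hε] with n hn x hx
    rw [dist_comm, Real.dist_eq]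
    exact (hlim x hx n).trans_lt hn
  refine ⟨g, ?_, ?_, fun x hx => ?_, hunif⟩
  · exact hunif.continuousOn (Frequently.of_forall fun n x _ =>
      (hasFDerivAt_kernelAverage hK f (τ n) x).continuousAt.continuousWithinAt)
  · have hae := ae_restrict_of_ae_restrict_of_subset hVΩ (ae_tendsto_kernelAverage hΩ hK hK1 f)
    filter_upwards [hae, ae_restrict_mem hVo.measurableSet] with x hx hxV
    refine tendsto_nhds_unique (hg x hxV) (hx.comp ?_)
    exact tendsto_nhdsWithin_iff.2 ⟨hτlim, Eventually.of_forall hτ0⟩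
  · have h0 := hlim x hx 0
    have h1 := abs_kernelAverage_one_le hV hK f hx
    have hτ00 : τ 0 = 1 := by simp [hτ]
    rw [hτ00, hb] at h0
    simp only [hτ00, Real.one_rpow, mul_one] at h0
    have h2 : √(∫ w, K w ^ 2) * ‖f‖ ≤ √(∫ w, K w ^ 2) * M := by
      gcongr
      exact hf.norm_le
    rw [add_mul]
    have h3 := abs_sub_abs_le_abs_sub (g x) (kernelAverage K f 1 x)
    rw [abs_sub_comm] at h3
    linarith

theorem tendstoUniformlyOn_sum_smul {ι X E : Type*} [NormedAddCommGroup E]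
    [NormedSpace ℝ E] (s : Finset ι) {a : ι → ℕ → X → ℝ} {b : ι → X → ℝ} {V : Set X}
    (h : ∀ i, TendstoUniformlyOn (a i) (b i) atTop V) (P : ι → E) :
    TendstoUniformlyOn (fun n x => ∑ i ∈ s, a i n x • P i) (fun x => ∑ i ∈ s, b i x • P i)
      atTop V := by
  classical
  induction s using Finset.induction_on with
  | empty =>
    simp only [Finset.sum_empty]
    exact (tendsto_const_nhds (x := (0 : E))).tendstoUniformlyOn_const V
  | insert i s hi ih =>
    simp only [Finset.sum_insert hi]
    have hu : UniformContinuous fun r : ℝ => r • P i :=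
      (ContinuousLinearMap.toSpanSingleton ℝ (P i)).uniformContinuous
    exact (hu.comp_tendstoUniformlyOn (h i)).add ih

/-- Averages commute with weak derivatives, so the limits of the averages of `f` and of its weak
partial derivatives are related by classical differentiation. -/
theorem hasFDerivAt_of_tendstoUniformlyOn_kernelAverage {N : ℕ}
    {Ω V : Set (EuclideanSpace ℝ (Fin N))} [IsFiniteMeasure (volume.restrict Ω)] (hVo : IsOpen V)
    {e : EuclideanSpace ℝ (Fin N)} {ρ : ℝ} (hV : HasInteriorCones Ω V e ρ)
    {K : EuclideanSpace ℝ (Fin N) → ℝ} (hK : IsTestFunction (Metric.ball e ρ) K)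
    {f : Lp ℝ 2 (volume.restrict Ω)} {h : Fin N → Lp ℝ 2 (volume.restrict Ω)}
    (hw : ∀ i, HasWeakDeriv Ω (Pi.single i 1) f (h i))
    {g : EuclideanSpace ℝ (Fin N) → ℝ} {g' : Fin N → EuclideanSpace ℝ (Fin N) → ℝ}
    (hg : TendstoUniformlyOn (fun (n : ℕ) x => kernelAverage K f (1 / ((n : ℝ) + 1)) x) g atTop V)
    (hg' : ∀ i, TendstoUniformlyOn (fun (n : ℕ) x => kernelAverage K (h i) (1 / ((n : ℝ) + 1)) x)
      (g' i) atTop V) {x : EuclideanSpace ℝ (Fin N)} (hx : x ∈ V) :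
    HasFDerivAt g (∑ i, g' i x • (EuclideanSpace.proj i : EuclideanSpace ℝ (Fin N) →L[ℝ] ℝ)) x := by
  refine hasFDerivAt_of_tendstoUniformlyOn hVo
    (tendstoUniformlyOn_sum_smul Finset.univ hg'
      (fun i => (EuclideanSpace.proj i : EuclideanSpace ℝ (Fin N) →L[ℝ] ℝ)))
    (fun n y hy => ?_) (fun y hy => hg.tendsto_at hy) hx
  have hn : (0 : ℝ) < 1 / ((n : ℝ) + 1) := by positivity
  have hn1 : 1 / ((n : ℝ) + 1) ≤ 1 := by
    rw [div_le_one (by positivity)]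
    linarith [(Nat.cast_nonneg n : (0 : ℝ) ≤ n)]
  refine (hasFDerivAt_kernelAverage hK f _ y).congr_fderiv ?_
  refine Finset.sum_congr rfl fun i _ => ?_
  rw [(hw i).setIntegral_partialDeriv_kernel hK hn (hV y hy _ hn hn1)]

/-- Near a boundary point the cones open in the direction of the axis `e` of the graph of the
`L`-Lipschitz function `γ`: moving by `t (h e + d)` raises the height by at least `t (h - |d|)` and
`γ` by at most `L t |d|`. -/
theorem IsLipschitzDomain.exists_interiorCones {N : ℕ} {Ω : Set (EuclideanSpace ℝ (Fin N))}
    (hΩ : IsLipschitzDomain Ω) {x₀ : EuclideanSpace ℝ (Fin N)} (hx₀ : x₀ ∈ closure Ω) :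
    ∃ (W : Set (EuclideanSpace ℝ (Fin N))) (e : EuclideanSpace ℝ (Fin N)) (ρ : ℝ),
      IsOpen W ∧ x₀ ∈ W ∧ 0 < ρ ∧ HasInteriorCones Ω (W ∩ Ω) e ρ := by
  by_cases hin : x₀ ∈ Ω
  · obtain ⟨ε, hε, hB⟩ := Metric.isOpen_iff.1 hΩ.isOpen x₀ hin
    refine ⟨Metric.ball x₀ (ε / 2), 0, ε / 2, Metric.isOpen_ball,
      Metric.mem_ball_self (by positivity), by positivity, fun x hx t ht ht1 w hw => hB ?_⟩
    have h1 : dist x x₀ < ε / 2 := hx.1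
    have h2 : ‖w‖ < ε / 2 := by simpa using hw
    have h3 : ‖t • w‖ ≤ ‖w‖ := by
      rw [norm_smul, Real.norm_of_nonneg ht.le]
      exact mul_le_of_le_one_left (norm_nonneg _) ht1
    rw [Metric.mem_ball]
    calc dist (x + t • w) x₀ ≤ dist (x + t • w) x + dist x x₀ := dist_triangle _ _ _
      _ = ‖t • w‖ + dist x x₀ := by simp [dist_eq_norm]
      _ < ε := by linarith
  · have hfr : x₀ ∈ frontier Ω := by
      rw [hΩ.isOpen.frontier_eq]
      exact ⟨hx₀, hin⟩
    obtain ⟨e, he, L, γ, hγ, V, hV, hVΩ⟩ := hΩ.lipschitz_boundary x₀ hfr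
    obtain ⟨ε, hε, hB⟩ := Metric.mem_nhds_iff.1 hV
    -- opening `κ` with `L κ < 1 - κ`, height `h` with `h (1 + κ) ≤ ε / 2`
    set κ : ℝ := 1 / (2 * (L + 1)) with hκ
    have hL : (0 : ℝ) ≤ L := L.2
    have hκ0 : 0 < κ := by positivity
    have hκ1 : κ ≤ 1 / 2 := by
      rw [hκ, div_le_div_iff₀ (by positivity) (by norm_num)]
      linarith
    have hLκ : L * κ < 1 - κ := by
      have : (L + 1) * κ = 1 / 2 := by
        rw [hκ]
        field_simp
      linarith
    set h : ℝ := ε / 4 with hh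
    have hh0 : 0 < h := by positivity
    refine ⟨Metric.ball x₀ (ε / 2), h • e, h * κ, Metric.isOpen_ball,
      Metric.mem_ball_self (by positivity), by positivity, fun x hx t ht ht1 w hw => ?_⟩
    have hx1 : dist x x₀ < ε / 2 := hx.1
    have hxV : x ∈ V := hB (Metric.ball_subset_ball (by linarith) hx.1)
    have hxe := (hVΩ x hxV).1 hx.2
    set d := w - h • e with hd
    have hdn : ‖d‖ < h * κ := by rwa [← dist_eq_norm]
    have hw' : w = h • e + d := by rw [hd]; abel
    have hwn : ‖w‖ < ε / 2 := by
      calc ‖w‖ ≤ ‖h • e‖ + ‖d‖ := by rw [hw']; exact norm_add_le _ _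
        _ < h + h * κ := by
          rw [norm_smul, he, mul_one, Real.norm_of_nonneg hh0.le]
          linarith
        _ ≤ ε / 2 := by
          have : h * κ ≤ h * (1 / 2) := by gcongr
          linarith
    have htw : ‖t • w‖ ≤ ‖w‖ := by
      rw [norm_smul, Real.norm_of_nonneg ht.le]
      exact mul_le_of_le_one_left (norm_nonneg _) ht1
    have hyV : x + t • w ∈ V := by
      refine hB ?_
      rw [Metric.mem_ball]
      calc dist (x + t • w) x₀ ≤ dist (x + t • w) x + dist x x₀ := dist_triangle _ _ _
        _ = ‖t • w‖ + dist x x₀ := by simp [dist_eq_norm]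
        _ < ε := by linarith
    rw [hVΩ _ hyV]
    set P := (Submodule.span ℝ {e})ᗮ.orthogonalProjectionOnto with hP
    have hPe : P e = 0 := by
      rw [hP]
      exact Submodule.orthogonalProjectionOnto_orthogonal_apply_eq_zero
        (Submodule.mem_span_singleton_self e)
    have hPw : ‖P w‖ ≤ ‖d‖ := by
      rw [hw', map_add, map_smul, hPe, smul_zero, zero_add]
      exact Submodule.norm_orthogonalProjectionOnto_apply_le _ d
    have hγle : γ (P (x + t • w)) ≤ γ (P x) + L * (t * ‖d‖) := by
      have h1 := hγ.dist_le_mul (P (x + t • w)) (P x)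
      rw [Real.dist_eq, dist_eq_norm, map_add, add_sub_cancel_left, map_smul, norm_smul,
        Real.norm_of_nonneg ht.le] at h1
      have h2 := (le_abs_self _).trans h1
      have h3 : (L : ℝ) * (t * ‖P w‖) ≤ L * (t * ‖d‖) := by gcongr
      rw [map_add, map_smul]
      linarith
    have hinner : inner ℝ e (x + t • w) ≥ inner ℝ e x + t * (h - ‖d‖) := by
      rw [inner_add_right, inner_smul_right, hw', inner_add_right, inner_smul_right,
        real_inner_self_eq_norm_sq, he]
      have h1 : -‖d‖ ≤ inner ℝ e d := by
        have := (abs_le.1 (abs_real_inner_le_norm e d)).1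
        rwa [he, one_mul] at this
      have h2 : t * (h - ‖d‖) ≤ t * (h * 1 ^ 2 + inner ℝ e d) := by
        gcongr
        linarith
      linarith
    have hkey : L * (t * ‖d‖) < t * (h - ‖d‖) := by
      have h1 : L * ‖d‖ + ‖d‖ < h := by
        have : ((L : ℝ) + 1) * ‖d‖ ≤ (L + 1) * (h * κ) := by gcongr
        have h2 : ((L : ℝ) + 1) * (h * κ) = h * (L * κ + κ) := by ring
        have h3 : h * (L * κ + κ) < h * 1 := by
          gcongr
          linarith
        linarith
      have h4 := mul_lt_mul_of_pos_left h1 ht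
      linarith
    linarith

/-! ### The Sobolev embedding on bounded Lipschitz domains -/

/-- If `h = ∂^α f` and `h' = ∂^(α + β) f`, then `h' = ∂^β h`. -/
theorem HasWeakDeriv.of_add {N : ℕ} {Ω : Set (EuclideanSpace ℝ (Fin N))} {α β : Fin N → ℕ}
    {f h h' : EuclideanSpace ℝ (Fin N) → ℝ} (H : HasWeakDeriv Ω α f h)
    (H' : HasWeakDeriv Ω (α + β) f h') : HasWeakDeriv Ω β h h' := by
  intro φ h1 h2 h3
  have hT : IsTestFunction Ω φ := ⟨h1, h2, h3⟩
  have hβ := hT.multiDeriv β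
  have e1 := H _ hβ.smooth hβ.compact hβ.subset
  have e2 := H' φ h1 h2 h3
  rw [multiDeriv_add α β h1, e1] at e2
  have hs : ∑ i, (α + β) i = ∑ i, α i + ∑ i, β i := by simp [Finset.sum_add_distrib]
  rw [hs, pow_add, mul_assoc] at e2
  exact mul_left_cancel₀ (pow_ne_zero _ (by norm_num)) e2

namespace SobolevSpace

variable {N : ℕ} {r : ℝ} {Ω : Set (EuclideanSpace ℝ (Fin N))}

/-- The weak derivative `∂^α F`, with the value zero for `|α| > ⌊r⌋`. -/
def weakDeriv (F : SobolevSpace r Ω) (α : Fin N → ℕ) : Lp ℝ 2 (volume.restrict Ω) :=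
  if h : ∑ i, α i ≤ ⌊r⌋₊ then F.1.fst ⟨α, h⟩ else 0

theorem weakDeriv_zero (F : SobolevSpace r Ω) : F.weakDeriv 0 = F.toLp := by
  unfold weakDeriv
  rw [dif_pos (by simp)]
  rfl

theorem weakDeriv_add (F G : SobolevSpace r Ω) (α : Fin N → ℕ) :
    (F + G).weakDeriv α = F.weakDeriv α + G.weakDeriv α := by
  unfold weakDeriv
  split_ifs
  · rfl
  · simp

theorem weakDeriv_smul (c : ℝ) (F : SobolevSpace r Ω) (α : Fin N → ℕ) :
    (c • F).weakDeriv α = c • F.weakDeriv α := by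
  unfold weakDeriv
  split_ifs
  · rfl
  · simp

theorem norm_weakDeriv_le (F : SobolevSpace r Ω) (α : Fin N → ℕ) : ‖F.weakDeriv α‖ ≤ ‖F‖ := by
  unfold weakDeriv
  split_ifs with h
  · exact (PiLp.norm_apply_le (p := 2) F.1.fst ⟨α, h⟩).trans (WithLp.norm_fst_le (p := 2) _ F.1)
  · simp

theorem hasWeakDeriv (F : SobolevSpace r Ω) {α β : Fin N → ℕ}
    (h : ∑ i, α i + ∑ i, β i ≤ ⌊r⌋₊) :
    HasWeakDeriv Ω β (F.weakDeriv α) (F.weakDeriv (α + β)) := by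
  have hs : ∑ i, (α + β) i = ∑ i, α i + ∑ i, β i := by simp [Finset.sum_add_distrib]
  have h1 : ∀ γ : Fin N → ℕ, ∑ i, γ i ≤ ⌊r⌋₊ → HasWeakDeriv Ω γ F.toLp (F.weakDeriv γ) := by
    intro γ hγ
    unfold weakDeriv
    rw [dif_pos hγ]
    exact F.2.1 ⟨γ, hγ⟩
  exact (h1 α (by omega)).of_add (h1 (α + β) (by omega))

theorem sobolevBound_weakDeriv (F : SobolevSpace r Ω) {α : Fin N → ℕ} (h : ∑ i, α i ≤ ⌊r⌋₊) :
    SobolevBound Ω (⌊r⌋₊ - ∑ i, α i) (r - ⌊r⌋₊) (F.weakDeriv α) ‖F‖ := by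
  refine ⟨F.norm_weakDeriv_le α, fun β hβ => ?_⟩
  have hs : ∑ i, (α + β) i = ⌊r⌋₊ := by
    simp only [Pi.add_apply, Finset.sum_add_distrib]
    omega
  refine ⟨F.weakDeriv (α + β), F.hasWeakDeriv (by omega), F.norm_weakDeriv_le _, ?_⟩
  refine ⟨F.1.snd ⟨⟨α + β, hs.le⟩, hs⟩, ?_,
    (PiLp.norm_apply_le (p := 2) F.1.snd _).trans (WithLp.norm_snd_le (p := 2) _ F.1)⟩
  unfold weakDeriv
  rw [dif_pos hs.le]
  exact F.2.2 ⟨⟨α + β, hs.le⟩, hs⟩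

/-- The functions `G α`, `|α| ≤ μ`, are continuous representatives on `V` of the weak derivatives
`∂^α F`, bounded by `B`, and `∂_i G α = G (α + e_i)` classically. -/
structure IsDerivFamily (F : SobolevSpace r Ω) (μ : ℕ) (V : Set (EuclideanSpace ℝ (Fin N)))
    (B : ℝ) (G : (Fin N → ℕ) → EuclideanSpace ℝ (Fin N) → ℝ) : Prop where
  continuousOn : ∀ α, ∑ i, α i ≤ μ → ContinuousOn (G α) V
  ae_eq : ∀ α, ∑ i, α i ≤ μ → G α =ᵐ[volume.restrict V] F.weakDeriv α
  bound : ∀ α, ∑ i, α i ≤ μ → ∀ x ∈ V, |G α x| ≤ B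
  hasFDerivAt : ∀ α, ∑ i, α i < μ → ∀ x ∈ V, HasFDerivAt (G α)
    (∑ i, G (α + Pi.single i 1) x •
      (EuclideanSpace.proj i : EuclideanSpace ℝ (Fin N) →L[ℝ] ℝ)) x

theorem sum_add_single (α : Fin N → ℕ) (i : Fin N) :
    ∑ l, (α + Pi.single i 1 : Fin N → ℕ) l = ∑ l, α l + 1 := by
  simp [Finset.sum_add_distrib]

/-- One kernel with vanishing moments up to order `⌊r⌋` serves all `∂^α F`, `|α| ≤ μ`, which lie in
`H^(r - |α|)`. -/
theorem exists_isDerivFamily_of_interiorCones {μ : ℕ} (hr : r - μ - (N : ℝ) / 2 > 0)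
    (hΩ : IsOpen Ω) [IsFiniteMeasure (volume.restrict Ω)] {V : Set (EuclideanSpace ℝ (Fin N))}
    (hVo : IsOpen V) (hVΩ : V ⊆ Ω) {e : EuclideanSpace ℝ (Fin N)} {ρ : ℝ} (hρ : 0 < ρ)
    (hV : HasInteriorCones Ω V e ρ) :
    ∃ C : ℝ, 0 ≤ C ∧ ∀ F : SobolevSpace r Ω, ∃ G, IsDerivFamily F μ V (C * ‖F‖) G := by
  obtain ⟨K, hK, hK1, hE⟩ := exists_kernel (Metric.isOpen_ball (x := e) (ε := ρ))
    ⟨e, Metric.mem_ball_self hρ⟩ ⌊r⌋₊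
  have hμ0 : (0 : ℝ) ≤ μ := Nat.cast_nonneg μ
  have hN0 : (0 : ℝ) ≤ (N : ℝ) / 2 := by positivity
  have hr0 : 0 ≤ r := by linarith
  have hσ : 0 ≤ r - ⌊r⌋₊ := sub_nonneg.2 (Nat.floor_le hr0)
  have hμr : μ ≤ ⌊r⌋₊ := Nat.le_floor (by linarith)
  have hloc : ∀ α : MultiIndex N μ, _ := fun α =>
    SobolevBound.exists_continuous_limit (k := ⌊r⌋₊ - ∑ i, α.1 i) (σ := r - ⌊r⌋₊) hΩ hVo hVΩ hρ hV
      hσ (by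
        have h1 : ((∑ i, α.1 i : ℕ) : ℝ) ≤ μ := by exact_mod_cast α.2
        rw [Nat.cast_sub (α.2.trans hμr)]
        linarith) hK hK1 (hE.of_le (by omega))
  choose C hC H using hloc
  have hCsum : ∀ α, C α ≤ ∑ α, C α := fun α =>
    Finset.single_le_sum (fun β _ => hC β) (Finset.mem_univ α)
  refine ⟨∑ α, C α, Finset.sum_nonneg fun α _ => hC α, fun F => ?_⟩
  choose g hg1 hg2 hg3 hg4 using fun α : MultiIndex N μ =>
    H α (F.weakDeriv α.1) ‖F‖ (F.sobolevBound_weakDeriv (α.2.trans hμr))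
  let G : (Fin N → ℕ) → EuclideanSpace ℝ (Fin N) → ℝ := fun α =>
    if h : ∑ i, α i ≤ μ then g ⟨α, h⟩ else 0
  have hG : ∀ α (h : ∑ i, α i ≤ μ), G α = g ⟨α, h⟩ := fun α h => dif_pos h
  refine ⟨G, fun α h => hG α h ▸ hg1 _, fun α h => hG α h ▸ hg2 _, fun α h x hx => ?_,
    fun α h x hx => ?_⟩
  · rw [hG α h]
    refine (hg3 _ x hx).trans ?_
    gcongr
    exact hCsum _
  · have hs : ∀ i, ∑ l, (α + Pi.single i 1 : Fin N → ℕ) l ≤ μ := fun i => by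
      rw [sum_add_single]
      omega
    refine hasFDerivAt_of_tendstoUniformlyOn_kernelAverage hVo hV hK
      (h := fun i => F.weakDeriv (α + Pi.single i 1)) (fun i => F.hasWeakDeriv ?_) ?_ (fun i => ?_)
      hx
    · have : ∑ l, (Pi.single i 1 : Fin N → ℕ) l = 1 := by simp
      omega
    · rw [hG α h.le]
      exact hg4 _
    · rw [hG _ (hs i)]
      exact hg4 _

theorem exists_isDerivFamily (hΩ : IsLipschitzDomain Ω) {μ : ℕ}
    (hr : r - μ - (N : ℝ) / 2 > 0) :
    ∃ C : ℝ, 0 ≤ C ∧ ∀ F : SobolevSpace r Ω, ∃ G, IsDerivFamily F μ Ω (C * ‖F‖) G := by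
  have : IsFiniteMeasure (volume.restrict Ω) :=
    isFiniteMeasure_restrict.2 hΩ.isBounded.measure_lt_top.ne
  choose! W e ρ hWo hxW hρ hcone using fun x₀ (hx₀ : x₀ ∈ closure Ω) =>
    hΩ.exists_interiorCones hx₀
  have hcomp : IsCompact (closure Ω) := hΩ.isBounded.isCompact_closure
  obtain ⟨t, ht, hcover⟩ := hcomp.elim_nhds_subcover W
    fun x hx => (hWo x hx).mem_nhds (hxW x hx)
  have hVo : ∀ y : t, IsOpen (W y ∩ Ω) := fun y => (hWo y (ht y y.2)).inter hΩ.isOpen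
  choose C hC H using fun y : t => exists_isDerivFamily_of_interiorCones (μ := μ) hr hΩ.isOpen
    (hVo y) Set.inter_subset_right (hρ y (ht y y.2)) (hcone y (ht y y.2))
  refine ⟨∑ y, C y, Finset.sum_nonneg fun y _ => hC y, fun F => ?_⟩
  choose G hG using fun y => H y F
  -- the local families agree on overlaps, being continuous and equal almost everywhere
  have hov : ∀ y z α, ∑ i, α i ≤ μ → Set.EqOn (G y α) (G z α) ((W y ∩ Ω) ∩ (W z ∩ Ω)) := by
    intro y z α hα
    refine Measure.eqOn_open_of_ae_eq (μ := volume) ?_ ((hVo y).inter (hVo z))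
      (((hG y).continuousOn α hα).mono Set.inter_subset_left)
      (((hG z).continuousOn α hα).mono Set.inter_subset_right)
    filter_upwards [ae_restrict_of_ae_restrict_of_subset Set.inter_subset_left ((hG y).ae_eq α hα),
      ae_restrict_of_ae_restrict_of_subset Set.inter_subset_right ((hG z).ae_eq α hα)] with x h1 h2
    rw [h1, h2]
  have hex : ∀ x, x ∈ Ω → ∃ y : t, x ∈ W y := by
    intro x hx
    have := hcover (subset_closure hx)
    simp only [Set.mem_iUnion] at this
    obtain ⟨y, hy, hxy⟩ := this
    exact ⟨⟨y, hy⟩, hxy⟩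
  by_cases hne : Nonempty t
  swap
  · refine ⟨fun _ _ => 0, ?_⟩
    have hemp : Ω = ∅ := Set.eq_empty_of_forall_notMem fun x hx => hne ⟨(hex x hx).choose⟩
    subst hemp
    constructor <;> simp [Filter.EventuallyEq]
  choose! j hj using hex
  let g : (Fin N → ℕ) → EuclideanSpace ℝ (Fin N) → ℝ := fun α x => G (j x) α x
  have hg : ∀ y α, ∑ i, α i ≤ μ → Set.EqOn (g α) (G y α) (W y ∩ Ω) := fun y α hα x hx =>
    hov (j x) y α hα ⟨⟨hj x hx.2, hx.2⟩, hx⟩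
  have hnhds : ∀ x ∈ Ω, W (j x) ∩ Ω ∈ 𝓝 x := fun x hx => (hVo (j x)).mem_nhds ⟨hj x hx, hx⟩
  refine ⟨g, fun α hα x hx => ?_, fun α hα => ?_, fun α hα x hx => ?_, fun α hα x hx => ?_⟩
  · have h1 := ((hG (j x)).continuousOn α hα).continuousAt (hnhds x hx)
    refine (h1.congr ?_).continuousWithinAt
    filter_upwards [hnhds x hx] with z hz using (hg _ α hα hz).symm
  · have hUn : Ω = ⋃ y : t, (W y ∩ Ω) := by
      refine Set.Subset.antisymm (fun x hx => Set.mem_iUnion.2 ⟨j x, hj x hx, hx⟩)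
        (Set.iUnion_subset fun y => Set.inter_subset_right)
    have : ∀ᵐ x ∂(volume.restrict (⋃ y : t, (W y ∩ Ω))), g α x = F.weakDeriv α x := by
      rw [ae_restrict_iUnion_iff]
      intro y
      filter_upwards [(hG y).ae_eq α hα, ae_restrict_mem (hVo y).measurableSet] with x hx hxm
      rw [hg y α hα hxm, hx]
    rwa [← hUn] at this
  · refine ((hG (j x)).bound α hα x ⟨hj x hx, hx⟩).trans ?_
    gcongr
    exact Finset.single_le_sum (fun y _ => hC y) (Finset.mem_univ _)
  · have h1 := (hG (j x)).hasFDerivAt α hα x ⟨hj x hx, hx⟩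
    have h2 : ∀ i, G (j x) (α + Pi.single i 1) x = g (α + Pi.single i 1) x := fun i => rfl
    simp_rw [h2] at h1
    refine h1.congr_of_eventuallyEq ?_
    filter_upwards [hnhds x hx] with z hz using hg _ α hα.le hz

namespace IsDerivFamily

variable {F : SobolevSpace r Ω} {μ : ℕ} {B : ℝ} {G : (Fin N → ℕ) → EuclideanSpace ℝ (Fin N) → ℝ}

theorem contDiffOn (hG : IsDerivFamily F μ Ω B G) (hΩ : IsOpen Ω) (n : ℕ) :
    ∀ α, ∑ i, α i + n ≤ μ → ContDiffOn ℝ n (G α) Ω := by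
  induction n with
  | zero =>
    intro α hα
    rw [Nat.cast_zero, contDiffOn_zero]
    exact hG.continuousOn α hα
  | succ n ih =>
    intro α hα
    have hα' : ∑ i, α i < μ := by omega
    push_cast
    rw [contDiffOn_succ_iff_fderiv_of_isOpen hΩ]
    refine ⟨fun x hx => (hG.hasFDerivAt α hα' x hx).differentiableAt.differentiableWithinAt,
      by simp, ?_⟩
    have h1 : ContDiffOn ℝ n (fun x => ∑ i, G (α + Pi.single i 1) x •
        (EuclideanSpace.proj i : EuclideanSpace ℝ (Fin N) →L[ℝ] ℝ)) Ω :=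
      ContDiffOn.sum fun i _ => (ih _ (by rw [sum_add_single]; omega)).smul contDiffOn_const
    exact h1.congr fun x hx => (hG.hasFDerivAt α hα' x hx).fderiv

theorem eqOn_partialDeriv (hG : IsDerivFamily F μ Ω B G) (hΩ : IsOpen Ω) {α : Fin N → ℕ}
    (i : Fin N) (hα : ∑ l, α l < μ) {g : EuclideanSpace ℝ (Fin N) → ℝ}
    (hg : Set.EqOn g (G α) Ω) : Set.EqOn (partialDeriv i g) (G (α + Pi.single i 1)) Ω := by
  intro x hx
  have h1 : g =ᶠ[𝓝 x] G α := Filter.eventuallyEq_of_mem (hΩ.mem_nhds hx) hg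
  unfold partialDeriv
  rw [h1.fderiv_eq, (hG.hasFDerivAt α hα x hx).fderiv]
  simp

theorem eqOn_partialDeriv_iterate (hG : IsDerivFamily F μ Ω B G) (hΩ : IsOpen Ω) (i : Fin N)
    (n : ℕ) {α : Fin N → ℕ} (hα : ∑ l, α l + n ≤ μ) {g : EuclideanSpace ℝ (Fin N) → ℝ}
    (hg : Set.EqOn g (G α) Ω) :
    Set.EqOn ((partialDeriv i)^[n] g) (G (α + Pi.single i n)) Ω := by
  induction n with
  | zero => simpa using hg
  | succ n ih =>
    have hs : ∑ l, (α + Pi.single i n : Fin N → ℕ) l = ∑ l, α l + n := by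
      simp [Finset.sum_add_distrib]
    have h1 := hG.eqOn_partialDeriv hΩ i (by rw [hs]; omega) (ih (by omega))
    rw [add_assoc, ← Pi.single_add] at h1
    rw [Function.iterate_succ_apply']
    exact h1

theorem eqOn_multiDeriv (hG : IsDerivFamily F μ Ω B G) (hΩ : IsOpen Ω) {α : Fin N → ℕ}
    (hα : ∑ i, α i ≤ μ) {g : EuclideanSpace ℝ (Fin N) → ℝ} (hg : Set.EqOn g (G 0) Ω) :
    Set.EqOn (multiDeriv α g) (G α) Ω := by
  have hsum : ∀ l : List (Fin N), ∑ k, ((l.map fun i => (Pi.single i (α i) : Fin N → ℕ)).sum) k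
      = (l.map α).sum := by
    intro l
    induction l with
    | nil => simp
    | cons i l ih => simp [Finset.sum_add_distrib, ih]
  have key : ∀ l : List (Fin N), (l.map α).sum ≤ μ →
      Set.EqOn (l.foldr (fun i h => (partialDeriv i)^[α i] h) g)
        (G (l.map fun i => (Pi.single i (α i) : Fin N → ℕ)).sum) Ω := by
    intro l
    induction l with
    | nil => intro _; simpa using hg
    | cons i l ih =>
      intro hl
      rw [List.map_cons, List.sum_cons] at hl
      have := hG.eqOn_partialDeriv_iterate hΩ i (α i) (by rw [hsum]; omega) (ih (by omega))
      rw [List.foldr_cons, List.map_cons, List.sum_cons, add_comm]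
      exact this
  have h1 := key (List.finRange N) (by rwa [← Fin.sum_univ_def])
  rw [← Fin.sum_univ_def, Finset.univ_sum_single] at h1
  exact h1

end IsDerivFamily

end SobolevSpace

theorem IsSmoothRep.eqOn {N : ℕ} {r : ℝ} {Ω : Set (EuclideanSpace ℝ (Fin N))} (hΩ : IsOpen Ω)
    {μ : ℕ} {F : SobolevSpace r Ω} {g g' : EuclideanSpace ℝ (Fin N) → ℝ} (h : IsSmoothRep μ F g)
    (h' : IsSmoothRep μ F g') : Set.EqOn g g' Ω :=
  Measure.eqOn_open_of_ae_eq (h.2.trans h'.2.symm) hΩ h.1.continuousOn h'.1.continuousOn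

/-- The Sobolev embedding `H^r(Ω) ⊂ C^μ_b(Ω)`, `r > μ + N / 2`: classical derivatives of the smooth
representative are continuous representatives of the weak ones and are bounded by the norm. -/
theorem IsLipschitzDomain.exists_isSmoothRep {N : ℕ} {r : ℝ}
    {Ω : Set (EuclideanSpace ℝ (Fin N))} (hΩ : IsLipschitzDomain Ω) {μ : ℕ}
    (hr : r - μ - (N : ℝ) / 2 > 0) :
    ∃ C : ℝ, 0 ≤ C ∧ ∀ F : SobolevSpace r Ω, (∃ g, IsSmoothRep μ F g) ∧
      ∀ g, IsSmoothRep μ F g → ∀ α : MultiIndex N μ, ContinuousOn (multiDeriv α.1 g) Ω ∧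
        multiDeriv α.1 g =ᵐ[volume.restrict Ω] F.weakDeriv α.1 ∧
        ∀ x ∈ Ω, |multiDeriv α.1 g x| ≤ C * ‖F‖ := by
  obtain ⟨C, hC, H⟩ := SobolevSpace.exists_isDerivFamily hΩ hr
  refine ⟨C, hC, fun F => ?_⟩
  obtain ⟨G, hG⟩ := H F
  have hrep : IsSmoothRep μ F (G 0) :=
    ⟨hG.contDiffOn hΩ.isOpen μ 0 (by simp), by
      rw [← F.weakDeriv_zero]
      exact hG.ae_eq 0 (by simp)⟩
  refine ⟨⟨_, hrep⟩, fun g hg α => ?_⟩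
  have h1 := hG.eqOn_multiDeriv hΩ.isOpen α.2 (hg.eqOn hΩ.isOpen hrep)
  refine ⟨(hG.continuousOn _ α.2).congr h1, ?_, fun x hx => ?_⟩
  · refine EventuallyEq.trans ?_ (hG.ae_eq _ α.2)
    filter_upwards [ae_restrict_mem hΩ.isOpen.measurableSet] with x hx using h1 hx
  · rw [h1 hx]
    exact hG.bound _ α.2 x hx

/-! ### Consistency of representatives in local coordinates -/

theorem hausdorffMeasure_eq_zero_iff_volume {d : ℕ} (S : Set (EuclideanSpace ℝ (Fin d))) :
    (μH[(d : ℝ)] : Measure (EuclideanSpace ℝ (Fin d))) S = 0 ↔ volume S = 0 := by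
  have h0 : (μH[(d : ℝ)] : Measure (EuclideanSpace ℝ (Fin d))).IsAddHaarMeasure := by
    simpa using MeasureTheory.isAddHaarMeasure_hausdorffMeasure (E := EuclideanSpace ℝ (Fin d))
  exact ⟨fun h => Measure.absolutelyContinuous_isAddHaarMeasure _ _ h,
    fun h => Measure.absolutelyContinuous_isAddHaarMeasure _ _ h⟩

namespace LipschitzAtlas

variable {d : ℕ} {Γ : Set (EuclideanSpace ℝ (Fin (d + 1)))} (A : LipschitzAtlas Γ)

theorem chart_injOn (j : Fin A.numCharts) : Set.InjOn (A.chart j) (A.dom j) := by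
  intro x hx y hy hxy
  obtain ⟨K, hK⟩ := A.chart_antilipschitz j
  have := hK x hx y hy
  rw [hxy, dist_self, mul_zero] at this
  exact dist_le_zero.1 this

/-- The inverse of the chart `φ_j`, defined on its image. -/
def chartInv (j : Fin A.numCharts) :
    EuclideanSpace ℝ (Fin (d + 1)) → EuclideanSpace ℝ (Fin d) :=
  Function.invFunOn (A.chart j) (A.dom j)

theorem chartInv_chart {j : Fin A.numCharts} {x : EuclideanSpace ℝ (Fin d)} (hx : x ∈ A.dom j) :
    A.chartInv j (A.chart j x) = x :=
  (A.chart_injOn j).leftInvOn_invFunOn hx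

theorem exists_lipschitzOnWith_chartInv (j : Fin A.numCharts) :
    ∃ K, LipschitzOnWith K (A.chartInv j) (A.chart j '' A.dom j) := by
  obtain ⟨K, hK⟩ := A.chart_antilipschitz j
  refine ⟨K.toNNReal, LipschitzOnWith.of_dist_le_mul ?_⟩
  rintro _ ⟨x, hx, rfl⟩ _ ⟨y, hy, rfl⟩
  rw [A.chartInv_chart hx, A.chartInv_chart hy]
  exact (hK x hx y hy).trans (by gcongr; exact Real.le_coe_toNNReal K)

/-- Transition maps are bi-Lipschitz, so they pull null sets back to null sets. -/
theorem volume_preimage_transition_eq_zero (i j : Fin A.numCharts)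
    {S : Set (EuclideanSpace ℝ (Fin d))} (hS : S ⊆ A.dom i) (h0 : volume S = 0) :
    volume {x | x ∈ A.dom j ∧ A.chart j x ∈ A.chart i '' S} = 0 := by
  obtain ⟨K, hK⟩ := A.chart_lipschitz i
  obtain ⟨K', hK'⟩ := A.exists_lipschitzOnWith_chartInv j
  have hd : (0 : ℝ) ≤ d := Nat.cast_nonneg d
  have h1 : μH[(d : ℝ)] (A.chart i '' S) = 0 := by
    have := (hK.mono hS).hausdorffMeasure_image_le hd
    rw [(hausdorffMeasure_eq_zero_iff_volume S).2 h0, mul_zero] at this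
    exact nonpos_iff_eq_zero.1 this
  have h2 : μH[(d : ℝ)] (A.chartInv j '' (A.chart i '' S ∩ A.chart j '' A.dom j)) = 0 := by
    have := (hK'.mono (Set.inter_subset_right (s := A.chart i '' S))).hausdorffMeasure_image_le hd
    rw [measure_mono_null Set.inter_subset_left h1, mul_zero] at this
    exact nonpos_iff_eq_zero.1 this
  refine measure_mono_null ?_ ((hausdorffMeasure_eq_zero_iff_volume _).1 h2)
  rintro x ⟨hx, hxS⟩
  exact ⟨A.chart j x, ⟨hxS, x, hx, rfl⟩, A.chartInv_chart hx⟩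

/-- Continuous functions on the parameter domains that represent almost everywhere one function
on `Γ` agree at every common point of two charts. -/
theorem eq_of_chart_eq {f : EuclideanSpace ℝ (Fin (d + 1)) → ℝ}
    {g : Fin A.numCharts → EuclideanSpace ℝ (Fin d) → ℝ}
    (hg : ∀ j, ContinuousOn (g j) (A.dom j))
    (hfg : ∀ j, f ∘ A.chart j =ᵐ[volume.restrict (A.dom j)] g j) {i j : Fin A.numCharts}
    {x y : EuclideanSpace ℝ (Fin d)} (hx : x ∈ A.dom j) (hy : y ∈ A.dom i)
    (hxy : A.chart j x = A.chart i y) : g j x = g i y := by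
  obtain ⟨V, hV, hVi⟩ := A.isOpen_image i
  have hcj : ContinuousOn (A.chart j) (A.dom j) := (A.chart_lipschitz j).choose_spec.continuousOn
  have hci : ContinuousOn (A.chartInv i) (A.chart i '' A.dom i) :=
    (A.exists_lipschitzOnWith_chartInv i).choose_spec.continuousOn
  set W := A.dom j ∩ A.chart j ⁻¹' V with hW
  have hWo : IsOpen W := hcj.isOpen_inter_preimage (A.dom_lipschitz j).isOpen hV
  have hmaps : ∀ z ∈ W, A.chart j z ∈ A.chart i '' A.dom i := by
    intro z hz
    rw [hVi]
    exact ⟨hz.2, A.cover.subset (Set.mem_iUnion.2 ⟨j, z, hz.1, rfl⟩)⟩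
  have hxW : x ∈ W := by
    refine ⟨hx, ?_⟩
    have : A.chart i y ∈ V ∩ Γ := hVi ▸ ⟨y, hy, rfl⟩
    rw [Set.mem_preimage, hxy]
    exact this.1
  have hinv : ∀ z ∈ W, A.chartInv i (A.chart j z) ∈ A.dom i ∧
      A.chart i (A.chartInv i (A.chart j z)) = A.chart j z := by
    intro z hz
    obtain ⟨w, hw, hwz⟩ := hmaps z hz
    rw [← hwz, A.chartInv_chart hw]
    exact ⟨hw, rfl⟩
  have hcont : ContinuousOn (fun z => g i (A.chartInv i (A.chart j z))) W :=
    (hg i).comp (hci.comp (hcj.mono Set.inter_subset_left) hmaps) fun z hz => (hinv z hz).1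
  have hae : g j =ᵐ[volume.restrict W] fun z => g i (A.chartInv i (A.chart j z)) := by
    set S := {z | z ∈ A.dom i ∧ ¬ (f ∘ A.chart i) z = g i z} with hS
    have hS0 : volume S = 0 := by
      have := hfg i
      rw [EventuallyEq, ae_restrict_iff' (A.dom_lipschitz i).isOpen.measurableSet, ae_iff] at this
      simpa [hS] using this
    have hT := A.volume_preimage_transition_eq_zero i j (S := S) (fun z hz => hz.1) hS0
    have hT' : ∀ᵐ z ∂(volume.restrict W),
        z ∉ {x | x ∈ A.dom j ∧ A.chart j x ∈ A.chart i '' S} :=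
      ae_restrict_of_ae (measure_eq_zero_iff_ae_notMem.1 hT)
    filter_upwards [hT', ae_restrict_of_ae_restrict_of_subset Set.inter_subset_left (hfg j),
      ae_restrict_mem hWo.measurableSet] with z hz hfz hzW
    obtain ⟨h1, h2⟩ := hinv z hzW
    rw [← hfz, Function.comp_apply]
    by_contra hne
    refine hz ⟨hzW.1, _, ⟨h1, ?_⟩, h2⟩
    rwa [Function.comp_apply, h2]
  have := Measure.eqOn_open_of_ae_eq hae hWo ((hg j).mono Set.inter_subset_left) hcont hxW
  simp only at this
  rw [this, hxy, A.chartInv_chart hy]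

end LipschitzAtlas

namespace BoundarySobolevSpace

variable {d : ℕ} {r : ℝ} {Γ : Set (EuclideanSpace ℝ (Fin (d + 1)))} {A : LipschitzAtlas Γ}

theorem norm_apply_le (F : BoundarySobolevSpace r A) (j : Fin A.numCharts) : ‖F.1 j‖ ≤ ‖F‖ :=
  PiLp.norm_apply_le (p := 2) F.1 j

theorem exists_isBoundarySmoothRep {μ : ℕ} (hr : r - μ - (d : ℝ) / 2 > 0)
    (F : BoundarySobolevSpace r A) : ∃ g, IsBoundarySmoothRep μ F g := by
  have hloc : ∀ j, ∃ g, IsSmoothRep μ (F.1 j) g := fun j => by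
    obtain ⟨C, -, H⟩ := (A.dom_lipschitz j).exists_isSmoothRep hr
    exact (H (F.1 j)).1
  choose g hg using hloc
  obtain ⟨f, hf⟩ := F.2
  have hagree : ∀ {i j : Fin A.numCharts} {x y : EuclideanSpace ℝ (Fin d)}, x ∈ A.dom j →
      y ∈ A.dom i → A.chart j x = A.chart i y → g j x = g i y := fun hx hy hxy =>
    A.eq_of_chart_eq (f := f) (fun j => (hg j).1.continuousOn)
      (fun j => (hf j).trans (hg j).2.symm) hx hy hxy
  classical
  let G : EuclideanSpace ℝ (Fin (d + 1)) → ℝ := fun y =>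
    if h : ∃ p : Fin A.numCharts × EuclideanSpace ℝ (Fin d), p.2 ∈ A.dom p.1 ∧
      A.chart p.1 p.2 = y then g h.choose.1 h.choose.2 else 0
  have hG : ∀ j, Set.EqOn (G ∘ A.chart j) (g j) (A.dom j) := by
    intro j x hx
    have h : ∃ p : Fin A.numCharts × EuclideanSpace ℝ (Fin d), p.2 ∈ A.dom p.1 ∧
      A.chart p.1 p.2 = A.chart j x := ⟨(j, x), hx, rfl⟩
    have h1 : G (A.chart j x) = g h.choose.1 h.choose.2 := dif_pos h
    rw [Function.comp_apply, h1]
    exact hagree h.choose_spec.1 hx h.choose_spec.2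
  refine ⟨G, fun j => ⟨(hg j).1.congr (hG j), ?_⟩⟩
  refine EventuallyEq.trans ?_ (hg j).2
  filter_upwards [ae_restrict_mem (A.dom_lipschitz j).isOpen.measurableSet] with x hx using hG j hx

end BoundarySobolevSpace

theorem IsBoundarySmoothRep.eqOn {d : ℕ} {r : ℝ} {Γ : Set (EuclideanSpace ℝ (Fin (d + 1)))}
    {A : LipschitzAtlas Γ} {μ : ℕ} {F : BoundarySobolevSpace r A}
    {g g' : EuclideanSpace ℝ (Fin (d + 1)) → ℝ} (h : IsBoundarySmoothRep μ F g)
    (h' : IsBoundarySmoothRep μ F g') : Set.EqOn g g' Γ := by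
  intro y hy
  obtain ⟨j, x, hx, rfl⟩ := Set.mem_iUnion.1 (A.cover.symm.subset hy)
  exact (h j).eqOn (A.dom_lipschitz j).isOpen (h' j) hx

/-! ### Sampling operators -/

/-- For `r > μ + N / 2`, point evaluations of derivatives of order at most `μ` are uniformly bounded
linear functionals on `H^r(Ω)`. -/
theorem IsLipschitzDomain.exists_derivEval {N : ℕ} {r : ℝ}
    {Ω : Set (EuclideanSpace ℝ (Fin N))} (hΩ : IsLipschitzDomain Ω) {μ : ℕ}
    (hr : r - μ - (N : ℝ) / 2 > 0) :
    ∃ C : ℝ, 0 ≤ C ∧ ∀ (α : MultiIndex N μ), ∀ x ∈ Ω, ∃ ℓ : SobolevSpace r Ω →ₗ[ℝ] ℝ,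
      (∀ F g, IsSmoothRep μ F g → ℓ F = multiDeriv α.1 g x) ∧ ∀ F, |ℓ F| ≤ C * ‖F‖ := by
  obtain ⟨C, hC, H⟩ := hΩ.exists_isSmoothRep hr
  choose rep hrep using fun F => (H F).1
  have hev : ∀ (F : SobolevSpace r Ω) g, IsSmoothRep μ F g → ∀ (α : MultiIndex N μ)
      (u : EuclideanSpace ℝ (Fin N) → ℝ), ContinuousOn u Ω →
      u =ᵐ[volume.restrict Ω] F.weakDeriv α.1 → Set.EqOn (multiDeriv α.1 g) u Ω := by
    intro F g hg α u hu hue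
    obtain ⟨h1, h2, -⟩ := (H F).2 g hg α
    exact Measure.eqOn_open_of_ae_eq (h2.trans hue.symm) hΩ.isOpen h1 hu
  refine ⟨C, hC, fun α x hx => ?_⟩
  let ℓ : SobolevSpace r Ω →ₗ[ℝ] ℝ :=
    { toFun := fun F => multiDeriv α.1 (rep F) x
      map_add' := fun F G => by
        obtain ⟨h1, h2, -⟩ := (H F).2 _ (hrep F) α
        obtain ⟨h3, h4, -⟩ := (H G).2 _ (hrep G) α
        refine hev (F + G) _ (hrep _) α (fun y => multiDeriv α.1 (rep F) y +
          multiDeriv α.1 (rep G) y) (h1.add h3) ?_ hx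
        rw [SobolevSpace.weakDeriv_add]
        filter_upwards [h2, h4, Lp.coeFn_add (F.weakDeriv α.1) (G.weakDeriv α.1)] with y e1 e2 e3
        rw [e3, Pi.add_apply, e1, e2]
      map_smul' := fun c F => by
        obtain ⟨h1, h2, -⟩ := (H F).2 _ (hrep F) α
        refine hev (c • F) _ (hrep _) α (fun y => c * multiDeriv α.1 (rep F) y)
          (continuousOn_const.mul h1) ?_ hx
        rw [SobolevSpace.weakDeriv_smul]
        filter_upwards [h2, Lp.coeFn_smul c (F.weakDeriv α.1)] with y e1 e2
        rw [e2, Pi.smul_apply, e1, smul_eq_mul] }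
  refine ⟨ℓ, fun F g hg => ?_, fun F => ((H F).2 _ (hrep F) α).2.2 x hx⟩
  obtain ⟨h1, h2, -⟩ := (H F).2 g hg α
  exact hev F _ (hrep F) α _ h1 h2 hx

theorem DiscreteTestSpace.exists_continuousLinearMap {T κ : Type} [NormedAddCommGroup T]
    [NormedSpace ℝ T] [Fintype κ] (s : Set.Ioi (0 : ℝ)) (n : ℕ) (ℓ : κ → T →ₗ[ℝ] ℝ) {C a : ℝ}
    (hC : 0 ≤ C) (ha : 0 ≤ a) (hℓ : ∀ p F, |ℓ p F| ≤ C * ‖F‖)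
    (hcard : (Fintype.card κ : ℝ) ≤ a * ((s : ℝ) ^ n)⁻¹) :
    ∃ π : T →L[ℝ] DiscreteTestSpace s n κ,
      (∀ F, π F = DiscreteTestSpace.mk s n fun p => ℓ p F) ∧ ‖π‖ ≤ √a * C := by
  have hs : (0 : ℝ) < s := s.2
  let L : T →ₗ[ℝ] DiscreteTestSpace s n κ :=
    { toFun := fun F => DiscreteTestSpace.mk s n fun p => ℓ p F
      map_add' := fun F G => by
        simp only [map_add]
        rfl
      map_smul' := fun c F => by
        simp only [map_smul]
        rfl }
  have hbound : ∀ F, ‖L F‖ ≤ √a * C * ‖F‖ := by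
    intro F
    have h1 : ‖toEuclidean s n κ (L F)‖ ≤ √(a * ((s : ℝ) ^ n)⁻¹) * (C * ‖F‖) := by
      change ‖(WithLp.toLp 2 fun p => ℓ p F : EuclideanSpace ℝ κ)‖ ≤ _
      rw [EuclideanSpace.norm_eq, ← Real.sqrt_sq (by positivity : 0 ≤ C * ‖F‖),
        ← Real.sqrt_mul (by positivity)]
      refine Real.sqrt_le_sqrt ?_
      calc ∑ p, ‖ℓ p F‖ ^ 2 ≤ ∑ _p : κ, (C * ‖F‖) ^ 2 := by
            refine Finset.sum_le_sum fun p _ => ?_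
            gcongr
            exact hℓ p F
        _ = Fintype.card κ * (C * ‖F‖) ^ 2 := by simp
        _ ≤ a * ((s : ℝ) ^ n)⁻¹ * (C * ‖F‖) ^ 2 := by gcongr
    have h2 : (s : ℝ) ^ ((n : ℝ) / 2) = √((s : ℝ) ^ n) := by
      rw [Real.sqrt_eq_rpow, ← Real.rpow_natCast, ← Real.rpow_mul hs.le]
      congr 1
      ring
    have h3 : √((s : ℝ) ^ n) * √(a * ((s : ℝ) ^ n)⁻¹) = √a := by
      rw [← Real.sqrt_mul (by positivity)]
      congr 1
      field_simp
    rw [norm_eq, h2]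
    refine (mul_le_mul_of_nonneg_left h1 (Real.sqrt_nonneg _)).trans (le_of_eq ?_)
    rw [← mul_assoc, h3, mul_assoc]
  exact ⟨L.mkContinuous _ hbound, fun F => rfl,
    L.mkContinuous_norm_le (by positivity) hbound⟩

theorem exists_domainSampling {N : ℕ} {r : ℝ} {Ω : Set (EuclideanSpace ℝ (Fin N))}
    (hΩ : IsLipschitzDomain Ω) {μ : ℕ} (hr : r - μ - (N : ℝ) / 2 > 0) (c : ℝ) :
    ∃ C : ℝ, 0 ≤ C ∧ ∀ (s : Set.Ioi (0 : ℝ)) (Y : DomainSample Ω c s),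
      ∃ π : SobolevSpace r Ω →L[ℝ] DiscreteTestSpace s N (MultiIndex N μ × Y.pts),
        (∀ F g, IsSmoothRep μ F g → π F = domainSamples Y μ g) ∧ ‖π‖ ≤ C := by
  obtain ⟨C, hC, H⟩ := hΩ.exists_derivEval hr
  refine ⟨√(Fintype.card (MultiIndex N μ) * |c|) * C, by positivity, fun s Y => ?_⟩
  choose ℓ h1 h2 using fun p : MultiIndex N μ × Y.pts => H p.1 p.2.1 (Y.pts_subset p.2.2)
  have hs : (0 : ℝ) < s := s.2
  obtain ⟨π, hπ, hn⟩ := DiscreteTestSpace.exists_continuousLinearMap s N ℓ hC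
    (a := Fintype.card (MultiIndex N μ) * |c|) (by positivity) h2 (by
      rw [Fintype.card_prod, Fintype.card_coe, Nat.cast_mul, mul_assoc]
      gcongr
      exact Y.card_le.trans (by gcongr; exact le_abs_self c))
  refine ⟨π, fun F g hg => ?_, hn⟩
  rw [hπ, domainSamples]
  congr 1
  funext p
  exact h1 p F g hg

theorem exists_boundarySampling {d : ℕ} {r : ℝ} {Γ : Set (EuclideanSpace ℝ (Fin (d + 1)))}
    (A : LipschitzAtlas Γ) {μ : ℕ} (hr : r - μ - (d : ℝ) / 2 > 0) (c : ℝ) :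
    ∃ C : ℝ, 0 ≤ C ∧ ∀ (s : Set.Ioi (0 : ℝ)) (Y : BoundarySample A c s),
      ∃ π : BoundarySobolevSpace r A →L[ℝ] DiscreteTestSpace s d (MultiIndex d μ × Y.pts),
        (∀ F g, IsBoundarySmoothRep μ F g → π F = boundarySamples Y μ g) ∧ ‖π‖ ≤ C := by
  choose C hC H using fun j => (A.dom_lipschitz j).exists_derivEval hr
  have hC' : 0 ≤ ∑ j, C j := Finset.sum_nonneg fun j _ => hC j
  refine ⟨√(Fintype.card (MultiIndex d μ) * |c|) * ∑ j, C j, by positivity, fun s Y => ?_⟩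
  choose ℓ h1 h2 using fun p : MultiIndex d μ × Y.pts =>
    H (Y.idx p.2) p.1 (Y.coord p.2) (Y.coord_mem p.2)
  have hs : (0 : ℝ) < s := s.2
  let proj : ∀ j, BoundarySobolevSpace r A →ₗ[ℝ] SobolevSpace r (A.dom j) := fun j =>
    { toFun := fun F => F.1 j
      map_add' := fun _ _ => rfl
      map_smul' := fun _ _ => rfl }
  obtain ⟨π, hπ, hn⟩ := DiscreteTestSpace.exists_continuousLinearMap s d
    (fun p => (ℓ p).comp (proj (Y.idx p.2))) hC'
    (a := Fintype.card (MultiIndex d μ) * |c|) (by positivity)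
    (fun p F => (h2 p (F.1 (Y.idx p.2))).trans (mul_le_mul
      (Finset.single_le_sum (fun j _ => hC j) (Finset.mem_univ _)) (F.norm_apply_le _)
      (norm_nonneg _) hC')) (by
      rw [Fintype.card_prod, Fintype.card_coe, Nat.cast_mul, mul_assoc]
      gcongr
      exact Y.card_le.trans (by gcongr; exact le_abs_self c))
  refine ⟨π, fun F g hg => ?_, hn⟩
  rw [hπ, boundarySamples]
  congr 1
  funext p
  exact h1 p (F.1 (Y.idx p.2)) _ (hg (Y.idx p.2))

/-- The norm of a diagonal map between `ℓ²`-products is at most the largest of the norms. -/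
theorem WithLp.exists_prodMap {E₁ E₂ F₁ F₂ : Type*} [NormedAddCommGroup E₁] [NormedSpace ℝ E₁]
    [NormedAddCommGroup E₂] [NormedSpace ℝ E₂] [NormedAddCommGroup F₁] [NormedSpace ℝ F₁]
    [NormedAddCommGroup F₂] [NormedSpace ℝ F₂] (p : E₁ →L[ℝ] F₁) (q : E₂ →L[ℝ] F₂) :
    ∃ π : WithLp 2 (E₁ × E₂) →L[ℝ] WithLp 2 (F₁ × F₂),
      (∀ x, π x = WithLp.toLp 2 (p x.fst, q x.snd)) ∧ ‖π‖ ≤ max ‖p‖ ‖q‖ := by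
  let L : WithLp 2 (E₁ × E₂) →ₗ[ℝ] WithLp 2 (F₁ × F₂) :=
    { toFun := fun x => WithLp.toLp 2 (p x.fst, q x.snd)
      map_add' := fun x y => by
        simp only [WithLp.add_fst, WithLp.add_snd, map_add]
        rfl
      map_smul' := fun c x => by
        simp only [WithLp.smul_fst, WithLp.smul_snd, map_smul]
        rfl }
  have hbound : ∀ x, ‖L x‖ ≤ max ‖p‖ ‖q‖ * ‖x‖ := by
    intro x
    have hm : 0 ≤ max ‖p‖ ‖q‖ := (norm_nonneg p).trans (le_max_left _ _)
    refine le_of_sq_le_sq ?_ (by positivity)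
    rw [mul_pow, WithLp.prod_norm_sq_eq_of_L2, WithLp.prod_norm_sq_eq_of_L2, mul_add, ← mul_pow,
      ← mul_pow]
    have h1 : ‖p x.fst‖ ≤ max ‖p‖ ‖q‖ * ‖x.fst‖ :=
      (p.le_opNorm _).trans (by gcongr; exact le_max_left _ _)
    have h2 : ‖q x.snd‖ ≤ max ‖p‖ ‖q‖ * ‖x.snd‖ :=
      (q.le_opNorm _).trans (by gcongr; exact le_max_right _ _)
    exact add_le_add (pow_le_pow_left₀ (norm_nonneg _) h1 2) (pow_le_pow_left₀ (norm_nonneg _) h2 2)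
  exact ⟨L.mkContinuous _ hbound, fun x => rfl,
    L.mkContinuous_norm_le ((norm_nonneg p).trans (le_max_left _ _)) hbound⟩

theorem proposition10 {d : ℕ} (Ω : Set (EuclideanSpace ℝ (Fin (d + 1))))
    (hΩ : IsLipschitzDomain Ω)
    (ΓD ΓN : Set (EuclideanSpace ℝ (Fin (d + 1))))
    (hD : ΓD ⊆ frontier Ω) (hN : ΓN ⊆ frontier Ω)
    (AD : LipschitzAtlas ΓD) (AN : LipschitzAtlas ΓN)
    (m : ℝ) (μ₁ μ₂ μ₃ : ℕ)
    (h₁ : m - μ₁ - ((d + 1 : ℕ) : ℝ) / 2 > 0)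
    (h₂ : (m + 3 / 2) - μ₂ - (d : ℝ) / 2 > 0)
    (h₃ : (m + 1 / 2) - μ₃ - (d : ℝ) / 2 > 0) :
    -- existence and uniqueness of the representatives whose derivatives are sampled
    (∀ f : TestSpace m Ω AD AN,
      ((∃ g, IsSmoothRep μ₁ f.fst g) ∧
        ∀ g g', IsSmoothRep μ₁ f.fst g → IsSmoothRep μ₁ f.fst g' → Set.EqOn g g' Ω) ∧
      ((∃ g, IsBoundarySmoothRep μ₂ f.snd.fst g) ∧
        ∀ g g', IsBoundarySmoothRep μ₂ f.snd.fst g → IsBoundarySmoothRep μ₂ f.snd.fst g' →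
          Set.EqOn g g' ΓD) ∧
      ((∃ g, IsBoundarySmoothRep μ₃ f.snd.snd g) ∧
        ∀ g g', IsBoundarySmoothRep μ₃ f.snd.snd g → IsBoundarySmoothRep μ₃ f.snd.snd g' →
          Set.EqOn g g' ΓN)) ∧
    -- the test discretization is a bounded linear map, with norm bounded independently of `s`
    ∀ c : ℝ, ∃ C : ℝ, ∀ (s : Set.Ioi (0 : ℝ)) (Y₁ : DomainSample Ω c s)
      (Y₂ : BoundarySample AD c s) (Y₃ : BoundarySample AN c s),
      ∃ π : TestSpace m Ω AD AN →L[ℝ] ProductDiscreteTestSpace μ₁ μ₂ μ₃ Y₁ Y₂ Y₃,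
        IsTestDiscretization μ₁ μ₂ μ₃ Y₁ Y₂ Y₃ π ∧
        (∀ π' : TestSpace m Ω AD AN → ProductDiscreteTestSpace μ₁ μ₂ μ₃ Y₁ Y₂ Y₃,
          IsTestDiscretization μ₁ μ₂ μ₃ Y₁ Y₂ Y₃ π' → π' = π) ∧
        ‖π‖ ≤ C := by
  have hex₁ : ∀ F : SobolevSpace m Ω, ∃ g, IsSmoothRep μ₁ F g := by
    obtain ⟨_, -, H⟩ := hΩ.exists_isSmoothRep h₁
    exact fun F => (H F).1
  have hex₂ : ∀ F : BoundarySobolevSpace (m + 3 / 2) AD, ∃ g, IsBoundarySmoothRep μ₂ F g :=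
    fun F => F.exists_isBoundarySmoothRep h₂
  have hex₃ : ∀ F : BoundarySobolevSpace (m + 1 / 2) AN, ∃ g, IsBoundarySmoothRep μ₃ F g :=
    fun F => F.exists_isBoundarySmoothRep h₃
  refine ⟨fun f => ⟨⟨hex₁ _, fun g g' hg hg' => hg.eqOn hΩ.isOpen hg'⟩,
    ⟨hex₂ _, fun g g' hg hg' => hg.eqOn hg'⟩, ⟨hex₃ _, fun g g' hg hg' => hg.eqOn hg'⟩⟩,
    fun c => ?_⟩
  obtain ⟨C₁, -, H₁⟩ := exists_domainSampling hΩ h₁ c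
  obtain ⟨C₂, -, H₂⟩ := exists_boundarySampling AD h₂ c
  obtain ⟨C₃, -, H₃⟩ := exists_boundarySampling AN h₃ c
  refine ⟨max C₁ (max C₂ C₃), fun s Y₁ Y₂ Y₃ => ?_⟩
  obtain ⟨π₁, hπ₁, hn₁⟩ := H₁ s Y₁
  obtain ⟨π₂, hπ₂, hn₂⟩ := H₂ s Y₂
  obtain ⟨π₃, hπ₃, hn₃⟩ := H₃ s Y₃
  obtain ⟨π₂₃, hπ₂₃, hn₂₃⟩ := WithLp.exists_prodMap π₂ π₃
  obtain ⟨π, hπ, hn⟩ := WithLp.exists_prodMap π₁ π₂₃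
  have hdisc : IsTestDiscretization μ₁ μ₂ μ₃ Y₁ Y₂ Y₃ π := by
    intro f g₁ g₂ g₃ hg₁ hg₂ hg₃
    rw [hπ, hπ₂₃, hπ₁ _ _ hg₁, hπ₂ _ _ hg₂, hπ₃ _ _ hg₃]
  refine ⟨π, hdisc, fun π' hπ' => funext fun f => ?_, ?_⟩
  · obtain ⟨g₁, hg₁⟩ := hex₁ f.fst
    obtain ⟨g₂, hg₂⟩ := hex₂ f.snd.fst
    obtain ⟨g₃, hg₃⟩ := hex₃ f.snd.snd
    rw [hπ' f g₁ g₂ g₃ hg₁ hg₂ hg₃, hdisc f g₁ g₂ g₃ hg₁ hg₂ hg₃]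
  · exact hn.trans (max_le_max hn₁ (hn₂₃.trans (max_le_max hn₂ hn₃)))

end
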